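/- Let $\mathbb{C}P^n$ carry the Fubini–Study metric of constant holomorphic sectional curvature $4$ and its complex structure $J$, and let $M^{2d}$ be a Kähler submanifold of $\mathbb{C}P^n$, i.e. a smooth immersed submanifold of real dimension $2d$ with $J(TM)=TM$, equipped with the induced metric $g$ and complex structure. Let the tangent bundle $TM$ and the normal bundle $NM$ be equipped with spin structures, let $\Sigma M$ and $\Sigma N$ be the associated complex spinor bundles, with the connection on $\Sigma N$ induced by the normal connection, and put $E:=\Sigma N$, $\Sigma:=\Sigma M\otimes\Sigma N$. Clifford multiplication satisfies $v\cdot v\,\cdot=-|v|^2$; on $\Sigma$, a tangent vector $X$ acts by $X\otimes(\mathrm{Id}_{\Sigma^+N}-\mathrm{Id}_{\Sigma^-N})$ and a normal vector $\nu$ by $\mathrm{Id}\otimes\nu$. Let $\Omega$ and $\Omega_N$ be the Kähler forms of $M$ and of $NM$, $\Omega(X,Y)=g(JX,Y)$ for tangent $X,Y$ and likewise for $\Omega_N$ on normal vectors, a $2$-form $\omega$ acting by $\sum_{i<j}\omega(b_i,b_j)\,b_i\cdot b_j\,\cdot$ for an orthonormal basis $(b_i)$. Let $II$ be the second fundamental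 form of the immersion, and let $R^E_{X,Y}=[\nabla_X,\nabla_Y]-\nabla_{[X,Y]}$ be the curvature of $E$. For an orthonormal basis $(e_i)_{1\le i\le 2d}$ of $T_xM$ put $$R^E(\psi):=2\sum_{i,j=1}^{2d}\big(e_i\cdot e_j\cdot\otimes R^E_{e_i,e_j}\big)\psi,\qquad R^E_\phi:=\Re\Big\langle R^E(\phi),\frac{\phi}{|\phi|^2}\Big\rangle,\qquad |II|^2:=\sum_{i,j=1}^{2d}|II(e_i,e_j)|^2,$$ where in $R^E(\psi)$ the dot denotes the Clifford multiplication of $M$ on $\Sigma M$. Then for every spinor field $\phi\in\Sigma$, at every point $x$ with $\phi(x)\neq 0$ and for every orthonormal basis $(e_i)_{1\le i\le 2d}$ of $T_xM$, $$R^E_\phi=-4\,\Re\Big\langle\Omega\cdot\Omega_N\cdot\phi,\frac{\phi}{|\phi|^2}\Big\rangle-\sum_{i,j,p=1}^{2d}\Re\Big\langle e_i\cdot e_j\cdot II(e_i,e_p)\cdot II(e_j,e_p)\cdot\phi,\frac{\phi}{|\phi|^2}\Big\rangle+|II|^2 .$$ -/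

import Mathlib

open scoped Manifold ContDiff TensorProduct

noncomputable section

namespace KaehlerSpin

/-! ## Complex projective space with its Fubini-Study geometry

A line `ℓ` of `ℂ^{n+1}` is identified with the orthogonal projection onto `ℓ`. This embeds `ℂPⁿ` as
a submanifold of the real vector space of self-adjoint endomorphisms of `ℂ^{n+1}`. The smooth
structure of `ℂPⁿ` is the one for which this is an embedding, and the Fubini-Study metric of
holomorphic sectional curvature `4` is the metric induced by `½ Re tr(AB)`. -/

/-- The Hermitian vector space `ℂ^{n+1}`. -/
abbrev V (n : ℕ) : Type := EuclideanSpace ℂ (Fin (n + 1))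

/-- Complex projective space `ℂPⁿ`. -/
abbrev CP (n : ℕ) : Type := Projectivization ℂ (V n)

/-- Endomorphisms of `ℂ^{n+1}`, in which `ℂPⁿ` and all its tangent spaces lie. -/
abbrev Op (n : ℕ) : Type := V n →L[ℂ] V n

/-- The point of `Op n` that represents a line: the orthogonal projection onto it. -/
def proj {n : ℕ} (l : CP n) : Op n := l.submodule.starProjection

/-- The form `½ Re tr(AB)`; on tangent vectors of `ℂPⁿ` it is the Fubini-Study metric. (If `v` is
a unit vector of the line and `w ⟂ v`, the tangent vector `w v^* + v w^*` has square length `|w|²`.) -/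
def gFS {n : ℕ} (A B : Op n) : ℝ :=
  (1 / 2) * (LinearMap.trace ℂ (V n) (A ∘L B : V n →L[ℂ] V n).toLinearMap).re

/-- The tangent space of `ℂPⁿ` at the line `l`: with `P = proj l`, it consists of the solutions of
the linearization `A^* = A`, `AP + PA = A` of the equations `P^* = P`, `P² = P`. -/
def tangentCP {n : ℕ} (l : CP n) : Submodule ℝ (Op n) where
  carrier := {A | ContinuousLinearMap.adjoint A = A ∧ A ∘L proj l + proj l ∘L A = A}
  add_mem' := by
    rintro A B ⟨h1, h2⟩ ⟨h3, h4⟩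
    refine ⟨by rw [map_add, h1, h3], ?_⟩
    rw [ContinuousLinearMap.add_comp, ContinuousLinearMap.comp_add, add_add_add_comm, h2, h4]
  zero_mem' := by simp
  smul_mem' := by
    rintro c A ⟨h1, h2⟩
    have e : c • A = (c : ℂ) • A := rfl
    refine ⟨?_, ?_⟩
    · rw [e, map_smulₛₗ, h1, Complex.conj_ofReal]
    · rw [e, ContinuousLinearMap.smul_comp, ContinuousLinearMap.comp_smul]
      exact (smul_add (c : ℂ) _ _).symm.trans (by rw [h2])

/-- The complex structure of `ℂPⁿ`: `A ↦ i (AP - PA)` with `P = proj l`. It sends `w v^* + v w^*` to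
`(iw) v^* + v (iw)^*`. -/
def cpxJ {n : ℕ} (l : CP n) (A : Op n) : Op n :=
  Complex.I • (A ∘L proj l - proj l ∘L A)

/-- The `gFS`-orthogonal projection of a self-adjoint endomorphism onto the tangent space
`tangentCP l`, i.e. `A ↦ P A (1 - P) + (1 - P) A P`. -/
def tangentPart {n : ℕ} (l : CP n) (A : Op n) : Op n :=
  proj l ∘L A ∘L (1 - proj l) + (1 - proj l) ∘L A ∘L proj l

open Classical in
/-- The `gFS`-orthogonal projection of `A` onto a subspace `W` (of the self-adjoint
endomorphisms, where `gFS` is positive definite, so that the projection exists and is unique). -/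
def orthPart {n : ℕ} (W : Submodule ℝ (Op n)) (A : Op n) : Op n :=
  if h : ∃ B ∈ W, ∀ C ∈ W, gFS (A - B) C = 0 then h.choose else 0

/-! ## Kähler submanifolds of `ℂPⁿ` -/

section Submanifold

variable {n k : ℕ} {M : Type*} [TopologicalSpace M] [ChartedSpace (EuclideanSpace ℝ (Fin k)) M]

/-- The differential of a map `f : M → ℂPⁿ`. -/
def dF (f : M → CP n) (x : M) : TangentSpace (𝓡 k) x →L[ℝ] Op n :=
  mfderiv (𝓡 k) 𝓘(ℝ, Op n) (fun y => proj (f y)) x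

/-- `f : M → ℂPⁿ` is a smooth immersion and `df(TM)` is stable under the complex structure of `ℂPⁿ`.
With the induced metric and complex structure `M` is then a Kähler manifold. -/
structure IsKaehlerImmersion (f : M → CP n) : Prop where
  smooth : ContMDiff (𝓡 k) 𝓘(ℝ, Op n) ∞ (fun y => proj (f y))
  injective : ∀ x, Function.Injective (dF (k := k) f x)
  stable : ∀ x (v : TangentSpace (𝓡 k) x), ∃ w : TangentSpace (𝓡 k) x,
    dF f x w = cpxJ (f x) (dF f x v)

/-- The fibre at `x` of the tangent bundle `TM`, as a subspace of the tangent space of `ℂPⁿ`. -/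
def tangentM (f : M → CP n) (x : M) : Submodule ℝ (Op n) :=
  LinearMap.range (dF (k := k) f x).toLinearMap

/-- The fibre at `x` of the normal bundle `NM`: the tangent vectors of `ℂPⁿ` at `f x` that are
orthogonal to `TM`. -/
def normalM (f : M → CP n) (x : M) : Submodule ℝ (Op n) where
  carrier := {A | A ∈ tangentCP (f x) ∧ ∀ B ∈ tangentM (k := k) f x, gFS A B = 0}
  add_mem' := by
    rintro A B ⟨h1, h2⟩ ⟨h3, h4⟩
    refine ⟨add_mem h1 h3, fun C hC => ?_⟩
    have := h2 C hC
    have := h4 C hC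
    simp only [gFS, ContinuousLinearMap.add_comp, ContinuousLinearMap.toLinearMap_add, map_add,
      Complex.add_re] at *
    linarith
  zero_mem' := ⟨zero_mem _, fun C _ => by simp [gFS]⟩
  smul_mem' := by
    rintro c A ⟨h1, h2⟩
    refine ⟨Submodule.smul_mem _ c h1, fun C hC => ?_⟩
    have h := h2 C hC
    have e : c • A = (c : ℂ) • A := rfl
    simp only [e, gFS, ContinuousLinearMap.smul_comp, ContinuousLinearMap.toLinearMap_smul,
      map_smul, smul_eq_mul, Complex.re_ofReal_mul] at *
    linear_combination c * h

/-- The Levi-Civita connection of `ℂPⁿ` on vector fields `Y` along `f`: since `ℂPⁿ` carries the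
metric induced from the Euclidean space of self-adjoint endomorphisms, it is the tangential part of
the flat derivative. -/
def leviCivita (f : M → CP n) (Y : M → Op n) (x : M) (v : TangentSpace (𝓡 k) x) : Op n :=
  tangentPart (f x) (mfderiv (𝓡 k) 𝓘(ℝ, Op n) Y x v)

/-- The normal connection `∇^N` of the immersion. -/
def normalConn (f : M → CP n) (ν : M → Op n) (x : M) (v : TangentSpace (𝓡 k) x) : Op n :=
  orthPart (normalM (k := k) f x) (leviCivita f ν x v)

variable [IsManifold (𝓡 k) ∞ M]

/-- The vector field near `x` with value `v` at `x` and constant components in the coordinates of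
the chart at `x`. Any two of these fields (for the same `x`) commute. -/
def coordField (x : M) (v : TangentSpace (𝓡 k) x) (y : M) : TangentSpace (𝓡 k) y :=
  (trivializationAt (EuclideanSpace ℝ (Fin k)) (TangentSpace (𝓡 k)) x).symmL ℝ y v

/-- The second fundamental form `II(v, w)` of the immersion: the normal part of the Levi-Civita
derivative in direction `v` of a vector field with value `w` at `x`. -/
def II (f : M → CP n) (x : M) (v w : TangentSpace (𝓡 k) x) : Op n :=
  orthPart (normalM (k := k) f x) (leviCivita f (fun y => dF f y (coordField x w y)) x v)

end Submanifold

/-! ## Spinor modules -/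

/-- The quadratic form `-|v|²` on `ℝ^r`; in its Clifford algebra `v · v = -|v|²`. -/
def negSq (r : ℕ) : QuadraticForm ℝ (EuclideanSpace ℝ (Fin r)) :=
  -(LinearMap.BilinMap.toQuadraticMap (innerₗ (EuclideanSpace ℝ (Fin r))))

/-- The standard basis vectors of `ℝ^r`. -/
def stdVec {r : ℕ} (i : Fin r) : EuclideanSpace ℝ (Fin r) := EuclideanSpace.single i 1

/-- `S` is the complex spinor module of `ℝ^{2m}`: the complex Clifford module of dimension `2^m`
(unique up to isomorphism), with an invariant Hermitian inner product. -/
structure SpinorModule (m : ℕ) (S : Type*) [NormedAddCommGroup S] [InnerProductSpace ℂ S] where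
  /-- Clifford multiplication by vectors -/
  cl : EuclideanSpace ℝ (Fin (2 * m)) →ₗ[ℝ] (S →L[ℂ] S)
  cl_sq : ∀ v s, cl v (cl v s) = -((‖v‖ ^ 2 : ℝ) : ℂ) • s
  cl_skew : ∀ v s t, inner ℂ (cl v s) t = -inner ℂ s (cl v t)
  finrank_eq : Module.finrank ℂ S = 2 ^ m

namespace SpinorModule

variable {m : ℕ} {S : Type*} [NormedAddCommGroup S] [InnerProductSpace ℂ S]

/-- The action of the Clifford algebra, in particular of the spin group, on the spinor module. -/
def rep (c : SpinorModule m S) : CliffordAlgebra (negSq (2 * m)) →ₐ[ℝ] (S →L[ℂ] S) :=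
  CliffordAlgebra.lift (negSq (2 * m)) ⟨c.cl, fun v => by
    ext s
    have h : negSq (2 * m) v = -(‖v‖ ^ 2) := by simp [negSq]
    rw [mul_apply_eq_comp, c.cl_sq, h, Algebra.algebraMap_eq_smul_one]
    simp [← Complex.coe_smul]⟩

/-- The complex volume element `i^m e_1 ⋯ e_{2m}`, which is `±1` on the half-spinors `S^±`; so this is
`Id_{S^+} - Id_{S^-}`. -/
def volume (c : SpinorModule m S) : S →L[ℂ] S :=
  Complex.I ^ m • (List.ofFn fun i : Fin (2 * m) => c.cl (stdVec i)).prod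

end SpinorModule

/-! ## Spin structures and spinors -/

section Spin

variable {n k : ℕ} {M : Type*} [TopologicalSpace M] [ChartedSpace (EuclideanSpace ℝ (Fin k)) M]

/-- A spin structure on a Euclidean vector bundle of rank `r` over `M`, here a bundle whose fibres
`W x` are subspaces of `Op n` with the metric `gFS`. It is given by an open cover of `M` with local
orthonormal frames and by lifts to the spin group of the transition functions between the frames
which satisfy the cocycle condition. -/
structure SpinStructure (W : M → Submodule ℝ (Op n)) (r : ℕ) (ι : Type*) where
  U : ι → Set M
  isOpen_U : ∀ a, IsOpen (U a)
  cover : ∀ x, ∃ a, x ∈ U a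
  /-- the local orthonormal frame over `U a` -/
  frame : ι → Fin r → M → Op n
  smooth_frame : ∀ a i, ContMDiffOn (𝓡 k) 𝓘(ℝ, Op n) ∞ (frame a i) (U a)
  orthonormal : ∀ a, ∀ x ∈ U a, ∀ i j, gFS (frame a i x) (frame a j x) = if i = j then 1 else 0
  span_eq : ∀ a, ∀ x ∈ U a, Submodule.span ℝ (Set.range fun i => frame a i x) = W x
  /-- the lifted transition functions -/
  lift : ι → ι → M → CliffordAlgebra (negSq r)
  lift_mem : ∀ a b, ∀ x ∈ U a ∩ U b, lift a b x ∈ spinGroup (negSq r)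
  /-- continuity of the lifts, with values in the finite-dimensional Clifford algebra -/
  lift_continuous : ∀ a b (l : CliffordAlgebra (negSq r) →ₗ[ℝ] ℝ),
    ContinuousOn (fun x => l (lift a b x)) (U a ∩ U b)
  /-- conjugation by `lift a b` is the change of components from the frame `b` to the frame `a` -/
  lift_conj : ∀ a b, ∀ x ∈ U a ∩ U b, ∀ j,
    lift a b x * CliffordAlgebra.ι (negSq r) (stdVec j) =
      CliffordAlgebra.ι (negSq r) (∑ i, gFS (frame b j x) (frame a i x) • stdVec i) * lift a b x
  cocycle : ∀ a b c, ∀ x ∈ U a ∩ U b ∩ U c, lift a b x * lift b c x = lift a c x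

/-- The components in the frame `a` of (the orthogonal projection onto `W x` of) the vector `A`. -/
def SpinStructure.coords {W : M → Submodule ℝ (Op n)} {r : ℕ} {ι : Type*}
    (σ : SpinStructure (k := k) W r ι) (a : ι) (x : M) (A : Op n) : EuclideanSpace ℝ (Fin r) :=
  ∑ i, gFS A (σ.frame a i x) • stdVec i

variable {f : M → CP n} {p q : ℕ} {ιM ιN : Type*}
  {SM SN : Type*} [NormedAddCommGroup SM] [InnerProductSpace ℂ SM]
  [NormedAddCommGroup SN] [InnerProductSpace ℂ SN]

/-- A spinor field, i.e. a section of `Σ = ΣM ⊗ ΣN`, where `ΣM` and `ΣN` are the spinor bundles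
associated with the spin structures of `TM` and `NM`: over `U a ∩ U b` it has a component with values
in the tensor product of the spinor modules, and the components are related by the lifted transition
functions. -/
structure SpinorField (σM : SpinStructure (k := k) (tangentM (k := k) f) (2 * p) ιM)
    (σN : SpinStructure (k := k) (normalM (k := k) f) (2 * q) ιN)
    (cM : SpinorModule p SM) (cN : SpinorModule q SN) where
  comp : ιM → ιN → M → SM ⊗[ℂ] SN
  comp_eq : ∀ a a' b b' x, x ∈ σM.U a → x ∈ σM.U a' → x ∈ σN.U b → x ∈ σN.U b' →
    comp a b x = TensorProduct.map (cM.rep (σM.lift a a' x)).toLinearMap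
      (cN.rep (σN.lift b b' x)).toLinearMap (comp a' b' x)

/-- Clifford multiplication by vectors of `ℂPⁿ` on `Σ = ΣM ⊗ ΣN`, on components in the frames `a` and
`b`: a vector `X` of `TM` acts by `X ⊗ (Id_{Σ^+ N} - Id_{Σ^- N})`, a vector `ν` of `NM` by `Id ⊗ ν`. -/
def cliff (σM : SpinStructure (k := k) (tangentM (k := k) f) (2 * p) ιM)
    (σN : SpinStructure (k := k) (normalM (k := k) f) (2 * q) ιN)
    (cM : SpinorModule p SM) (cN : SpinorModule q SN) (a : ιM) (b : ιN) (x : M) (A : Op n) :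
    Module.End ℂ (SM ⊗[ℂ] SN) :=
  TensorProduct.map (cM.cl (σM.coords a x A)).toLinearMap cN.volume.toLinearMap +
    TensorProduct.map LinearMap.id (cN.cl (σN.coords b x A)).toLinearMap

/-- The Clifford action `½ ∑_{i,j} Ω(b_i, b_j) b_i · b_j ·` (that is, the sum over `i < j`) of the Kähler
form `Ω(X, Y) = g(JX, Y)` of a complex subbundle, where `b` is an orthonormal basis of its fibre at
`x` and `cl` is Clifford multiplication. -/
def kaehlerAction {S : Type*} [AddCommGroup S] [Module ℂ S] (l : CP n) (cl : Op n → Module.End ℂ S)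
    {r : ℕ} (b : Fin r → Op n) : Module.End ℂ S :=
  (1 / 2 : ℂ) • ∑ i, ∑ j, (gFS (cpxJ l (b i)) (b j) : ℂ) • (cl (b i) * cl (b j))

/-- The connection form, over `U b`, of the connection on `ΣN` induced by the normal connection:
`¼ ∑_{i,j} g(∇^N ν_i, ν_j) e_i · e_j ·`, where `ν_i` is the frame `b`. -/
def spinConnForm (σN : SpinStructure (k := k) (normalM (k := k) f) (2 * q) ιN)
    (cN : SpinorModule q SN) (b : ιN) (y : M) (v : TangentSpace (𝓡 k) y) : SN →L[ℂ] SN :=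
  (1 / 4 : ℂ) • ∑ i, ∑ j,
    (gFS (normalConn f (σN.frame b i) y v) (σN.frame b j y) : ℂ) •
      (cN.cl (stdVec i) * cN.cl (stdVec j))

/-- The covariant derivative `∇_v` of sections of `ΣN` over `U b`, on components in the frame `b`. It is
applied to a family `s ↦ Ψ(·) s` of sections which depends linearly on a parameter `s`. -/
def spinCov (σN : SpinStructure (k := k) (normalM (k := k) f) (2 * q) ιN)
    (cN : SpinorModule q SN) (b : ιN) (Ψ : M → (SN →L[ℂ] SN)) (y : M) (v : TangentSpace (𝓡 k) y) :
    SN →L[ℂ] SN :=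
  (show SN →L[ℂ] SN from mfderiv (𝓡 k) 𝓘(ℝ, SN →L[ℂ] SN) Ψ y v) + spinConnForm σN cN b y v * Ψ y

variable [IsManifold (𝓡 k) ∞ M]

/-- The curvature `R^{ΣN}_{v,w}` of `ΣN` at `x`, on components in the frame `b`: the operator
`∇_V ∇_W - ∇_W ∇_V` on the sections with constant component `s`, where `V` and `W` are the commuting
coordinate fields with values `v` and `w` at `x` (so that the term `∇_{[V,W]}` vanishes). -/
def spinCurv (σN : SpinStructure (k := k) (normalM (k := k) f) (2 * q) ιN)
    (cN : SpinorModule q SN) (b : ιN) (x : M) (v w : TangentSpace (𝓡 k) x) : SN →L[ℂ] SN :=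
  spinCov σN cN b (fun y => spinCov σN cN b (fun _ => 1) y (coordField x w y)) x v -
    spinCov σN cN b (fun y => spinCov σN cN b (fun _ => 1) y (coordField x v y)) x w

/-- The curvature endomorphism `R^E = 2 ∑_{i,j} e_i · e_j · ⊗ R^E_{e_i,e_j}` of `ΣM ⊗ E` for `E = ΣN`, on
components in the frames `a` and `b`; `e` is an orthonormal basis of the tangent space of `M`
at `x`, and the Clifford multiplication is the one of `M`. -/
def twistCurv (σM : SpinStructure (k := k) (tangentM (k := k) f) (2 * p) ιM)
    (σN : SpinStructure (k := k) (normalM (k := k) f) (2 * q) ιN)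
    (cM : SpinorModule p SM) (cN : SpinorModule q SN) (a : ιM) (b : ιN) (x : M)
    {r : ℕ} (e : Fin r → TangentSpace (𝓡 k) x) : Module.End ℂ (SM ⊗[ℂ] SN) :=
  (2 : ℂ) • ∑ i, ∑ j, TensorProduct.map
    (cM.cl (σM.coords a x (dF f x (e i))) * cM.cl (σM.coords a x (dF f x (e j)))).toLinearMap
    (spinCurv σN cN b x (e i) (e j)).toLinearMap

end Spin

/-- `Re ⟨ψ, φ / |φ|²⟩`. -/
def rePair {S : Type*} [NormedAddCommGroup S] [InnerProductSpace ℂ S] (ψ φ : S) : ℝ :=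
  (inner ℂ ψ ((((‖φ‖ ^ 2)⁻¹ : ℝ) : ℂ) • φ)).re

end KaehlerSpin

end

open KaehlerSpin

/-!
The curvature of `E = ΣN` is the image of the curvature of the normal bundle under the spin
representation, and the normal curvature is given by the Ricci equation. The theorem follows by
inserting one into the other and reordering Clifford products; it holds already as an identity of
endomorphisms (`twistCurv_eq`), and pairing with `φ / |φ|²` only turns the scalar term into `|II|²`.

*Spinor curvature* (`spinCurv_eq`). In the chart at `x`, the connection form of `ΣN` is
`¼ ∑ g(Dν_i, ν_j) e_i · e_j ·`, with the flat derivative `D` of the normal frame `ν` as an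
`Op n`-valued map, because `ν_j` is normal and the projections in the definition of the normal
connection do not change the pairing with it. The second derivatives of `ν` cancel in
`∇_V ∇_W - ∇_W ∇_V`, and the commutator of the connection forms is the commutator of matrices
(`bivector_commutator`). What remains is the Clifford element of the matrix
`g(D_w ν_i, D_v ν_j) - g(D_v ν_i, D_w ν_j)` without the contributions of the normal components.

*Ricci equation* (`ricci_equation`). Split `D_w ν_i` orthogonally into its parts tangent to `M`,
normal to `M` in `ℂPⁿ`, and normal to `ℂPⁿ` in the self-adjoint endomorphisms. The part tangent to
`M` is given by the second fundamental form (`gFS_II_frame`). The part normal to `ℂPⁿ` comes from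
the derivative of `νP + Pν = ν`: it is `(1 - 2P)(ν W + W ν)` with `W = df(w)`
(`sub_tangentPart_of_deriv`). As `1 - 2P` is an involution that commutes with such anticommutators,
only `g(ν_i W + W ν_i, ν_j V + V ν_j)` skew-symmetrized in `v, w` enters, which is
`½ Re tr([ν_i, ν_j] [V, W]) = -2 Ω(v, w) Ω_N(ν_i, ν_j)` (`gFS_anticommutators`). This replaces the
curvature tensor of `ℂPⁿ`; it uses that the normal space is complex orthogonal to the tangent space.

*Clifford algebra* (`sum_curvature`). On `ΣM ⊗ ΣN`, products of two tangent vectors act on the first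
factor only, since the complex volume element squares to `1` (`SpinorModule.volume_mul_self`). The
Kähler form term is then `-4 Ω · Ω_N`. The skew-symmetrization in `i, j` turns the other term into
minus the sum of `e_i · e_j · II(e_i, e_p) · II(e_j, e_p) ·` over `i ≠ j`; the diagonal terms of the
full sum are the scalars `|II(e_i, e_p)|²`, whence the summand `|II|²`.
-/

noncomputable section

open scoped Topology
open ContinuousLinearMap (adjoint)

namespace KaehlerSpin

variable {n : ℕ}

/-! ### The bilinear form `gFS` -/

/-- The trace of endomorphisms of `ℂ^{n+1}` as a complex linear form. -/
def opTrace (n : ℕ) : Op n →ₗ[ℂ] ℂ :=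
  (LinearMap.trace ℂ (V n)) ∘ₗ (ContinuousLinearMap.coeLM ℂ)

lemma opTrace_mul_comm (A B : Op n) : opTrace n (A * B) = opTrace n (B * A) :=
  LinearMap.trace_mul_comm ℂ A.toLinearMap B.toLinearMap

lemma gFS_eq (A B : Op n) : gFS A B = (1 / 2) * (opTrace n (A * B)).re := rfl

/-- `gFS` as a continuous real bilinear form on `Op n`. -/
def gForm (n : ℕ) : Op n →L[ℝ] Op n →L[ℝ] ℝ :=
  (LinearMap.mk₂ ℝ (fun A B : Op n => gFS A B)
    (fun A A' B => by simp only [gFS_eq, add_mul, map_add, Complex.add_re]; ring)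
    (fun c A B => by
      have e : c • A = (c : ℂ) • A := rfl
      simp only [gFS_eq, e, smul_mul_assoc, map_smul, smul_eq_mul, Complex.re_ofReal_mul]
      exact mul_left_comm _ _ _)
    (fun A B B' => by simp only [gFS_eq, mul_add, map_add, Complex.add_re])
    (fun c A B => by
      have e : c • B = (c : ℂ) • B := rfl
      simp only [gFS_eq, e, mul_smul_comm, map_smul, smul_eq_mul, Complex.re_ofReal_mul]; ring)
    ).toContinuousBilinearMap

lemma gForm_apply (A B : Op n) : gForm n A B = gFS A B := rfl

lemma gFS_comm (A B : Op n) : gFS A B = gFS B A := by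
  rw [gFS_eq, gFS_eq, opTrace_mul_comm]

lemma gFS_add_left (A A' B : Op n) : gFS (A + A') B = gFS A B + gFS A' B := by
  simp only [← gForm_apply, map_add, add_apply]

lemma gFS_sub_left (A A' B : Op n) : gFS (A - A') B = gFS A B - gFS A' B := by
  simp only [← gForm_apply, map_sub, sub_apply]

lemma gFS_sub_right (A B B' : Op n) : gFS A (B - B') = gFS A B - gFS A B' := by
  simp only [← gForm_apply, map_sub]

lemma gFS_smul_left (c : ℝ) (A B : Op n) : gFS (c • A) B = c * gFS A B := by
  simp only [← gForm_apply, map_smul, smul_apply, smul_eq_mul]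

lemma gFS_smul_right (c : ℝ) (A B : Op n) : gFS A (c • B) = c * gFS A B := by
  simp only [← gForm_apply, map_smul, smul_eq_mul]

lemma gFS_sum_left {ι : Type*} (s : Finset ι) (A : ι → Op n) (B : Op n) :
    gFS (∑ i ∈ s, A i) B = ∑ i ∈ s, gFS (A i) B := by
  simp only [← gForm_apply, map_sum, sum_apply]

lemma gFS_sum_right {ι : Type*} (s : Finset ι) (A : Op n) (B : ι → Op n) :
    gFS A (∑ i ∈ s, B i) = ∑ i ∈ s, gFS A (B i) := by
  simp only [← gForm_apply, map_sum]

/-! ### Orthonormal families -/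

lemma eq_sum_gFS_of_mem_span {ι : Type*} [Fintype ι] [DecidableEq ι] {s : ι → Op n}
    (hs : ∀ i j, gFS (s i) (s j) = if i = j then 1 else 0) {A : Op n}
    (hA : A ∈ Submodule.span ℝ (Set.range s)) : A = ∑ i, gFS A (s i) • s i := by
  obtain ⟨c, rfl⟩ := (Submodule.mem_span_range_iff_exists_fun ℝ).1 hA
  refine Finset.sum_congr rfl fun i _ => ?_
  simp [gFS_sum_left, gFS_smul_left, hs]

lemma linearIndependent_of_gFS {ι : Type*} [Fintype ι] [DecidableEq ι] {s : ι → Op n}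
    (hs : ∀ i j, gFS (s i) (s j) = if i = j then 1 else 0) : LinearIndependent ℝ s := by
  rw [Fintype.linearIndependent_iff]
  intro c hc i
  have h : gFS (∑ j, c j • s j) (s i) = 0 := by rw [hc, ← gForm_apply]; simp
  simpa [gFS_sum_left, gFS_smul_left, hs] using h

/-- An orthonormal family with as many members as an orthonormal spanning family spans as well. -/
lemma span_eq_of_gFS {r : ℕ} {W : Submodule ℝ (Op n)} {s t : Fin r → Op n}
    (hs : ∀ i j, gFS (s i) (s j) = if i = j then 1 else 0)
    (hW : Submodule.span ℝ (Set.range s) = W)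
    (ht : ∀ i j, gFS (t i) (t j) = if i = j then 1 else 0) (htW : ∀ i, t i ∈ W) :
    Submodule.span ℝ (Set.range t) = W := by
  have h1 := finrank_span_eq_card (linearIndependent_of_gFS hs)
  have h2 := finrank_span_eq_card (linearIndependent_of_gFS ht)
  refine Submodule.eq_of_le_of_finrank_eq (Submodule.span_le.2 ?_) ?_
  · rintro _ ⟨i, rfl⟩; exact htW i
  · rw [h2, ← h1, hW]

/-- An orthonormal basis of `W` provides the projection of every `A`, self-adjoint or not. -/
lemma orthPart_eq_sum {ι : Type*} [Fintype ι] [DecidableEq ι] {W : Submodule ℝ (Op n)}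
    {s : ι → Op n} (hs : ∀ i j, gFS (s i) (s j) = if i = j then 1 else 0)
    (hW : Submodule.span ℝ (Set.range s) = W) (A : Op n) :
    orthPart W A = ∑ i, gFS A (s i) • s i := by
  have hsW : ∀ i, s i ∈ W := fun i => hW ▸ Submodule.subset_span ⟨i, rfl⟩
  have h : ∃ B ∈ W, ∀ C ∈ W, gFS (A - B) C = 0 := by
    refine ⟨∑ i, gFS A (s i) • s i,
      Submodule.sum_mem _ fun i _ => Submodule.smul_mem _ _ (hsW i), fun C hC => ?_⟩
    rw [eq_sum_gFS_of_mem_span hs (A := C) (hW.symm ▸ hC)]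
    simp [gFS_sub_left, gFS_sum_left, gFS_sum_right, gFS_smul_left, gFS_smul_right, hs]
  rw [orthPart, dif_pos h]
  obtain ⟨h1, h2⟩ := h.choose_spec
  rw [eq_sum_gFS_of_mem_span hs (A := h.choose) (hW.symm ▸ h1)]
  refine Finset.sum_congr rfl fun i _ => ?_
  have := h2 _ (hsW i)
  rw [gFS_sub_left, sub_eq_zero] at this
  rw [this]

/-! ### The tangent space of projective space at a point -/

lemma proj_mul_self (l : CP n) : proj l * proj l = proj l :=
  l.submodule.isIdempotentElem_starProjection

lemma adjoint_proj (l : CP n) : adjoint (proj l) = proj l := by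
  have := (isSelfAdjoint_starProjection l.submodule)
  exact this

/-- A unit vector `p` of a line `l`, with `proj l = p p^*`. -/
lemma exists_unit_vector (l : CP n) : ∃ p : V n, ‖p‖ = 1 ∧ ∀ x, proj l x = inner ℂ p x • p := by
  have h0 : l.rep ≠ 0 := l.rep_nonzero
  refine ⟨((‖l.rep‖⁻¹ : ℝ) : ℂ) • l.rep, ?_, fun x => ?_⟩
  · rw [norm_smul]; simp [h0]
  · have := Submodule.starProjection_singleton ℂ (v := l.rep) x
    unfold proj
    have e : l.submodule = ℂ ∙ l.rep := l.submodule_eq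
    simp only [e, this, inner_smul_left, smul_smul, Complex.conj_ofReal]
    congr 1
    push_cast
    rw [div_eq_mul_inv, sq, mul_inv, mul_comm, mul_assoc, mul_comm (_⁻¹) (inner ℂ _ _)]
    exact (mul_assoc _ _ _).symm

/-- `A` is tangent to `ℂPⁿ` at `l`, written multiplicatively. -/
lemma mem_tangentCP {l : CP n} {A : Op n} :
    A ∈ tangentCP l ↔ adjoint A = A ∧ A * proj l + proj l * A = A := Iff.rfl

section Point

variable {l : CP n} {A B C D : Op n}

lemma proj_mul_mul_proj (hA : A ∈ tangentCP l) : proj l * (A * proj l) = 0 := by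
  have h := congrArg (fun X => proj l * X) (mem_tangentCP.1 hA).2
  simp only [mul_add, ← mul_assoc, proj_mul_self] at h
  rw [← mul_assoc]; simpa using h

lemma mul_one_sub_proj (hA : A ∈ tangentCP l) : A * (1 - proj l) = proj l * A := by
  rw [mul_sub, mul_one, sub_eq_iff_eq_add', (mem_tangentCP.1 hA).2]

lemma one_sub_proj_mul (hA : A ∈ tangentCP l) : (1 - proj l) * A = A * proj l := by
  rw [sub_mul, one_mul, sub_eq_iff_eq_add, (mem_tangentCP.1 hA).2]

lemma opTrace_proj_mul {p : V n} (hp : ∀ x, proj l x = inner ℂ p x • p) (A : Op n) :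
    opTrace n (proj l * A) = inner ℂ p (A p) := by
  have : (A * proj l) = InnerProductSpace.rankOne ℂ (A p) p := by
    ext1 x; simp [hp]
  rw [opTrace_mul_comm, this]
  exact InnerProductSpace.trace_rankOne _ _

lemma inner_apply_eq (hA : A ∈ tangentCP l) (x y : V n) : inner ℂ (A x) y = inner ℂ x (A y) := by
  conv_lhs => rw [← (mem_tangentCP.1 hA).1]
  exact ContinuousLinearMap.adjoint_inner_left _ _ _

lemma opTrace_split (l : CP n) (A : Op n) :
    opTrace n A = opTrace n (proj l * A) + opTrace n ((1 - proj l) * A) := by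
  rw [← map_add, ← add_mul]; simp

lemma opTrace_mul_tangent {p : V n} (hp : ∀ x, proj l x = inner ℂ p x • p)
    (hA : A ∈ tangentCP l) (hB : B ∈ tangentCP l) :
    opTrace n (A * B) = inner ℂ (A p) (B p) + inner ℂ (B p) (A p) := by
  rw [opTrace_split l, ← mul_assoc (1 - proj l), one_sub_proj_mul hA, mul_assoc,
    opTrace_mul_comm A, mul_assoc, opTrace_proj_mul hp, opTrace_proj_mul hp]
  simp [inner_apply_eq hA, inner_apply_eq hB]

lemma gFS_tangent {p : V n} (hp : ∀ x, proj l x = inner ℂ p x • p)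
    (hA : A ∈ tangentCP l) (hB : B ∈ tangentCP l) : gFS A B = (inner ℂ (A p) (B p)).re := by
  rw [gFS_eq, opTrace_mul_tangent hp hA hB, ← inner_conj_symm (B p)]
  simp only [Complex.add_re, Complex.conj_re]
  ring

lemma tangent_tangent_apply {p : V n} (h1 : ‖p‖ = 1) (hp : ∀ x, proj l x = inner ℂ p x • p)
    (hA : A ∈ tangentCP l) (hB : B ∈ tangentCP l) : A (B p) = inner ℂ (A p) (B p) • p := by
  have hpp : proj l p = p := by rw [hp, inner_self_eq_norm_sq_to_K, h1]; simp
  have h : proj l * (A * B) = A * B * proj l := by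
    rw [← mul_assoc, ← mul_one_sub_proj hA, mul_assoc, one_sub_proj_mul hB, mul_assoc]
  have := congrArg (fun X : Op n => X p) h
  simp only [mul_apply_eq_comp, hpp] at this
  rw [← this, hp, inner_apply_eq hA]

/-- The trace of a fourfold product of tangent vectors; the second summand comes from the complement
of the line. -/
lemma opTrace_mul_four {p : V n} (h1 : ‖p‖ = 1) (hp : ∀ x, proj l x = inner ℂ p x • p)
    (hA : A ∈ tangentCP l) (hB : B ∈ tangentCP l) (hC : C ∈ tangentCP l) (hD : D ∈ tangentCP l) :
    opTrace n (A * B * (C * D)) = inner ℂ (A p) (B p) * inner ℂ (C p) (D p)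
      + inner ℂ (B p) (C p) * inner ℂ (D p) (A p) := by
  have e : opTrace n ((1 - proj l) * (A * B * (C * D))) =
      opTrace n (proj l * (B * C * (D * A))) := by
    rw [mul_assoc A, ← mul_assoc (1 - proj l), one_sub_proj_mul hA, mul_assoc,
      opTrace_mul_comm A]
    simp only [mul_assoc]
  have key : ∀ {A B C D : Op n}, A ∈ tangentCP l → B ∈ tangentCP l → C ∈ tangentCP l →
      D ∈ tangentCP l → opTrace n (proj l * (A * B * (C * D))) =
        inner ℂ (A p) (B p) * inner ℂ (C p) (D p) := by
    intro A B C D hA hB hC hD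
    rw [opTrace_proj_mul hp]
    simp only [mul_apply_eq_comp, tangent_tangent_apply h1 hp hC hD, map_smul,
      tangent_tangent_apply h1 hp hA hB, inner_smul_right, inner_self_eq_norm_sq_to_K, h1]
    simp; ring
  rw [opTrace_split l, e, key hA hB hC hD, key hB hC hD hA]

lemma cpxJ_apply {p : V n} (h1 : ‖p‖ = 1) (hp : ∀ x, proj l x = inner ℂ p x • p)
    (hA : A ∈ tangentCP l) : cpxJ l A p = Complex.I • A p := by
  have hpp : proj l p = p := by rw [hp, inner_self_eq_norm_sq_to_K, h1]; simp
  have h := congrArg (fun X : Op n => X p) (proj_mul_mul_proj hA)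
  simp only [mul_apply_eq_comp, hpp] at h
  simp [cpxJ, hpp, h]

lemma cpxJ_mem (hA : A ∈ tangentCP l) : cpxJ l A ∈ tangentCP l := by
  have h2 := proj_mul_mul_proj hA
  refine mem_tangentCP.2 ⟨?_, ?_⟩
  · have : adjoint (A * proj l - proj l * A) = -(A * proj l - proj l * A) := by
      have e : ∀ X Y : Op n, adjoint (X * Y) = adjoint Y * adjoint X :=
        fun X Y => ContinuousLinearMap.adjoint_comp X Y
      rw [map_sub, e, e, adjoint_proj, (mem_tangentCP.1 hA).1]; abel
    change adjoint (Complex.I • (A * proj l - proj l * A)) = Complex.I • (A * proj l - proj l * A)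
    rw [map_smulₛₗ, this, Complex.conj_I, neg_smul]
    exact (congrArg Neg.neg (smul_neg Complex.I _)).trans (neg_neg _)
  · change Complex.I • (A * proj l - proj l * A) * proj l +
      proj l * Complex.I • (A * proj l - proj l * A) = Complex.I • (A * proj l - proj l * A)
    rw [smul_mul_assoc, mul_smul_comm]
    refine (smul_add Complex.I _ _).symm.trans ?_
    congr 1
    rw [sub_mul, mul_sub, mul_assoc, proj_mul_self, mul_assoc, h2, ← mul_assoc (proj l),
      proj_mul_self]
    abel

lemma gFS_cpxJ {p : V n} (h1 : ‖p‖ = 1) (hp : ∀ x, proj l x = inner ℂ p x • p)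
    (hA : A ∈ tangentCP l) (hB : B ∈ tangentCP l) :
    gFS (cpxJ l A) B = (inner ℂ (A p) (B p)).im := by
  rw [gFS_tangent hp (cpxJ_mem hA) hB, cpxJ_apply h1 hp hA, inner_smul_left]
  simp

/-- The term of constant holomorphic sectional curvature in the Ricci equation, for `B` complex
orthogonal to `C` and `D`. Up to the isometry `1 - 2P`, the anticommutator of two tangent vectors is
the value of the second fundamental form of `ℂPⁿ` in `Op n`, so that the left hand side is
`⟨R(C, D)A, B⟩` by the Gauss equation. -/
lemma gFS_anticommutators (hA : A ∈ tangentCP l) (hB : B ∈ tangentCP l)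
    (hC : C ∈ tangentCP l) (hD : D ∈ tangentCP l)
    (hBC : gFS B C = 0) (hBC' : gFS (cpxJ l C) B = 0)
    (hBD : gFS B D = 0) (hBD' : gFS (cpxJ l D) B = 0) :
    gFS (A * D + D * A) (B * C + C * B) - gFS (A * C + C * A) (B * D + D * B) =
      -2 * gFS (cpxJ l C) D * gFS (cpxJ l A) B := by
  obtain ⟨p, h1, hp⟩ := exists_unit_vector l
  have orth : ∀ {X : Op n}, X ∈ tangentCP l → gFS B X = 0 → gFS (cpxJ l X) B = 0 →
      inner ℂ (X p) (B p) = 0 ∧ inner ℂ (B p) (X p) = 0 := by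
    intro X hX e1 e2
    rw [gFS_comm, gFS_tangent hp hX hB] at e1
    rw [gFS_cpxJ h1 hp hX hB] at e2
    have : inner ℂ (X p) (B p) = 0 := Complex.ext e1 e2
    exact ⟨this, inner_eq_zero_symm.1 this⟩
  obtain ⟨c1, c2⟩ := orth hC hBC hBC'
  obtain ⟨d1, d2⟩ := orth hD hBD hBD'
  have t1 : opTrace n (A * D * (C * B)) = opTrace n (B * A * (D * C)) := by
    rw [← mul_assoc, opTrace_mul_comm]; simp only [mul_assoc]
  have t2 : opTrace n (D * A * (B * C)) = opTrace n (A * B * (C * D)) := by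
    rw [mul_assoc, opTrace_mul_comm]; simp only [mul_assoc]
  have t3 : opTrace n (A * C * (D * B)) = opTrace n (B * A * (C * D)) := by
    rw [← mul_assoc, opTrace_mul_comm]; simp only [mul_assoc]
  have t4 : opTrace n (C * A * (B * D)) = opTrace n (A * B * (D * C)) := by
    rw [mul_assoc, opTrace_mul_comm]; simp only [mul_assoc]
  have t5 : opTrace n (A * D * (B * C)) = opTrace n (C * A * (D * B)) := by
    rw [← mul_assoc, opTrace_mul_comm]; simp only [mul_assoc]
  have t6 : opTrace n (D * A * (C * B)) = opTrace n (A * C * (B * D)) := by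
    rw [mul_assoc, opTrace_mul_comm]; simp only [mul_assoc]
  rw [gFS_cpxJ h1 hp hC hD, gFS_cpxJ h1 hp hA hB]
  simp only [gFS_eq, add_mul, mul_add, map_add, t1, t2, t3, t4, t5, t6,
    opTrace_mul_four h1 hp hA hB hC hD, opTrace_mul_four h1 hp hB hA hD hC,
    opTrace_mul_four h1 hp hB hA hC hD, opTrace_mul_four h1 hp hA hB hD hC, c1, c2, d1, d2,
    zero_mul, mul_zero, add_zero]
  rw [← inner_conj_symm (B p) (A p), ← inner_conj_symm (D p) (C p)]
  simp only [Complex.add_re, Complex.mul_re, Complex.conj_re, Complex.conj_im]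
  ring

lemma tangentPart_eq (l : CP n) (A : Op n) : tangentPart l A =
    proj l * (A * (1 - proj l)) + (1 - proj l) * (A * proj l) := rfl

lemma tangentPart_eq' (l : CP n) (A : Op n) : tangentPart l A =
    A * proj l + proj l * A - (proj l * (A * proj l) + proj l * (A * proj l)) := by
  rw [tangentPart_eq, mul_sub, sub_mul, mul_sub, mul_one, one_mul]; abel

lemma gFS_tangentPart (A : Op n) (hB : B ∈ tangentCP l) : gFS (tangentPart l A) B = gFS A B := by
  have h2 := proj_mul_mul_proj hB
  have h3 : opTrace n (proj l * (A * proj l) * B) = 0 := by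
    rw [mul_assoc, opTrace_mul_comm, mul_assoc, mul_assoc, ]
    rw [h2]; simp
  rw [tangentPart_eq', gFS_sub_left, gFS_add_left (proj l * _), gFS_eq (proj l * _), h3,
    gFS_eq, gFS_eq]
  conv_rhs => rw [← (mem_tangentCP.1 hB).2]
  rw [add_mul, mul_add, map_add, map_add, mul_assoc (proj l), opTrace_mul_comm (proj l)]
  simp only [mul_assoc]
  simp [add_comm]

lemma tangentPart_mem (hA : adjoint A = A) : tangentPart l A ∈ tangentCP l := by
  have e : ∀ X Y : Op n, adjoint (X * Y) = adjoint Y * adjoint X :=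
    fun X Y => ContinuousLinearMap.adjoint_comp X Y
  have hP := proj_mul_self l
  have hP' : ∀ X, proj l * (proj l * X) = proj l * X := fun X => by rw [← mul_assoc, hP]
  refine mem_tangentCP.2 ⟨?_, ?_⟩
  · have : adjoint (1 : Op n) = 1 := star_one _
    rw [tangentPart_eq, map_add, e, e, e, e, map_sub, this, adjoint_proj, hA]
    simp only [mul_assoc]
    exact add_comm _ _
  · rw [tangentPart_eq]
    simp only [mul_add, add_mul, mul_sub, sub_mul, mul_one, one_mul, mul_assoc, hP, hP']
    abel

/-- The splitting of `Op n` into endomorphisms that exchange and that preserve the line and its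
complement is orthogonal. -/
lemma gFS_split (l : CP n) (A B : Op n) : gFS A B =
    gFS (tangentPart l A) (tangentPart l B) + gFS (A - tangentPart l A) (B - tangentPart l B) := by
  have hP := proj_mul_self l
  have hP' : ∀ X, proj l * (proj l * X) = proj l * X := fun X => by rw [← mul_assoc, hP]
  have key : ∀ A B : Op n, gFS (tangentPart l A) (B - tangentPart l B) = 0 := by
    intro A B
    have c1 : proj l * (B - tangentPart l B) = (B - tangentPart l B) * proj l := by
      rw [tangentPart_eq]
      simp only [mul_add, add_mul, mul_sub, sub_mul, mul_one, one_mul, mul_assoc, hP, hP']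
      abel
    set X := B - tangentPart l B
    have h1 : opTrace n (proj l * (A * proj l) * X) = opTrace n (A * (proj l * X)) := by
      rw [mul_assoc, opTrace_mul_comm, mul_assoc, mul_assoc, ← c1, hP']
    rw [tangentPart_eq', gFS_sub_left, gFS_add_left (proj l * _), gFS_eq (proj l * _), h1,
      gFS_eq, add_mul, map_add, mul_assoc, mul_assoc, opTrace_mul_comm (proj l), mul_assoc, ← c1]
    simp; ring
  have k1 := key A B
  have k2 := key B A
  rw [gFS_sub_right] at k1 k2
  rw [gFS_sub_left, gFS_sub_right, gFS_sub_right, gFS_comm A (tangentPart l B)]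
  rw [gFS_comm (tangentPart l B) (tangentPart l A)] at k2
  linarith

/-- If `A'` solves the equation obtained by differentiating `AP + PA = A` with `P' = D`, then the
part of `A'` normal to `ℂPⁿ` is `(1 - 2P)(AD + DA)`. -/
lemma sub_tangentPart_of_deriv {A' : Op n}
    (h : A' * proj l + A * D + (proj l * A' + D * A) = A') :
    A' - tangentPart l A' = (1 - (proj l + proj l)) * (A * D + D * A) := by
  have hP := proj_mul_self l
  have hP' : ∀ X, proj l * (proj l * X) = proj l * X := fun X => by rw [← mul_assoc, hP]
  have e1 : (A * D + D * A) = A' - A' * proj l - proj l * A' := by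
    rw [sub_sub, eq_sub_iff_add_eq]
    conv_rhs => rw [← h]
    abel
  rw [e1, tangentPart_eq', sub_mul, one_mul, add_mul]
  simp only [mul_sub, hP']
  abel

lemma gFS_reflection_mul (hA : A ∈ tangentCP l) (hD : D ∈ tangentCP l) :
    gFS ((1 - (proj l + proj l)) * (A * D + D * A)) ((1 - (proj l + proj l)) * (B * C + C * B)) =
      gFS (A * D + D * A) (B * C + C * B) := by
  have hP := proj_mul_self l
  have comm : ∀ {X Y : Op n}, X ∈ tangentCP l → Y ∈ tangentCP l →
      X * Y * proj l = proj l * (X * Y) := by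
    intro X Y hX hY
    rw [mul_assoc, ← one_sub_proj_mul hY, ← mul_assoc, mul_one_sub_proj hX, mul_assoc]
  have c : (A * D + D * A) * (1 - (proj l + proj l)) =
      (1 - (proj l + proj l)) * (A * D + D * A) := by
    simp only [add_mul, mul_add, mul_sub, sub_mul, mul_one, one_mul, comm hA hD, comm hD hA]
    abel
  have s : (1 - (proj l + proj l)) * (1 - (proj l + proj l)) = 1 := by
    simp only [mul_sub, sub_mul, mul_add, add_mul, mul_one, one_mul, hP]
    abel
  rw [gFS_eq, gFS_eq, ← c, mul_assoc, ← mul_assoc (1 - _) (1 - _), s, one_mul]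

end Point

/-! ### Clifford algebra -/

section CliffordIdentities

variable {𝒜 : Type*} [Ring 𝒜] [Algebra ℂ 𝒜]

lemma bivector_commutator_vector {r : ℕ} {g : Fin r → 𝒜}
    (hg : ∀ i j, g i * g j + g j * g i = (if i = j then -2 else 0 : ℂ) • 1)
    {a : Fin r → Fin r → ℂ} (ha : ∀ i j, a i j = -a j i) (k : Fin r) :
    (∑ i, ∑ j, a i j • (g i * g j)) * g k - g k * (∑ i, ∑ j, a i j • (g i * g j)) =
      ∑ j, (4 * a k j) • g j := by
  have h : ∀ i j, g i * g j * g k - g k * (g i * g j) =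
      (if j = k then -2 else 0 : ℂ) • g i - (if k = i then -2 else 0 : ℂ) • g j := by
    intro i j
    have h1 : g i * (g j * g k + g k * g j) = (if j = k then -2 else 0 : ℂ) • g i := by
      rw [hg, mul_smul_comm, mul_one]
    have h2 : (g k * g i + g i * g k) * g j = (if k = i then -2 else 0 : ℂ) • g j := by
      rw [hg, smul_mul_assoc, one_mul]
    rw [← h1, ← h2]
    noncomm_ring
  have e : (∑ i, ∑ j, a i j • (g i * g j)) * g k - g k * (∑ i, ∑ j, a i j • (g i * g j)) =
      ∑ i, ∑ j, a i j • (g i * g j * g k - g k * (g i * g j)) := by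
    simp only [Finset.sum_mul, Finset.mul_sum, smul_mul_assoc, mul_smul_comm, smul_sub,
      Finset.sum_sub_distrib]
  rw [e]
  simp only [h, smul_sub, Finset.sum_sub_distrib, ite_smul, zero_smul, smul_ite, smul_zero,
    Finset.sum_ite_eq', Finset.mem_univ, if_true]
  rw [Finset.sum_comm]
  simp only [Finset.sum_ite_eq, Finset.mem_univ, if_true, smul_smul, ← Finset.sum_sub_distrib,
    ← sub_smul]
  refine Finset.sum_congr rfl fun j _ => ?_
  rw [ha j k]
  congr 1; ring

/-- The map `a ↦ ¼ ∑ a_{ij} g_i g_j` from skew matrices to the Clifford algebra turns matrix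
commutators into commutators. -/
lemma bivector_commutator {r : ℕ} {g : Fin r → 𝒜}
    (hg : ∀ i j, g i * g j + g j * g i = (if i = j then -2 else 0 : ℂ) • 1)
    {a b : Fin r → Fin r → ℂ} (ha : ∀ i j, a i j = -a j i) :
    ((1 / 4 : ℂ) • ∑ i, ∑ j, a i j • (g i * g j)) * ((1 / 4 : ℂ) • ∑ i, ∑ j, b i j • (g i * g j))
      - ((1 / 4 : ℂ) • ∑ i, ∑ j, b i j • (g i * g j)) *
        ((1 / 4 : ℂ) • ∑ i, ∑ j, a i j • (g i * g j)) =
      (1 / 4 : ℂ) • ∑ i, ∑ j, (∑ m, (b i m * a m j - a i m * b m j)) • (g i * g j) := by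
  set A := ∑ i, ∑ j, a i j • (g i * g j) with hA
  have key : ∀ k l, A * (g k * g l) - g k * g l * A =
      (∑ j, (4 * a k j) • g j) * g l + g k * ∑ j, (4 * a l j) • g j := by
    intro k l
    rw [← bivector_commutator_vector hg ha, ← bivector_commutator_vector hg ha, ← hA]
    noncomm_ring
  have e : A * (∑ i, ∑ j, b i j • (g i * g j)) - (∑ i, ∑ j, b i j • (g i * g j)) * A =
      ∑ k, ∑ l, b k l • (A * (g k * g l) - g k * g l * A) := by
    simp only [Finset.sum_mul, Finset.mul_sum, smul_mul_assoc, mul_smul_comm, smul_sub,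
      Finset.sum_sub_distrib]
  have e1 : ∑ k, ∑ l, b k l • ((∑ j, (4 * a k j) • g j) * g l) =
      ∑ i, ∑ j, (4 * ∑ m, (-(a i m * b m j))) • (g i * g j) := by
    simp only [Finset.sum_mul, Finset.smul_sum, smul_mul_assoc, smul_smul]
    calc _ = ∑ k, ∑ j, ∑ l, (b k l * (4 * a k j)) • (g j * g l) :=
          Finset.sum_congr rfl fun k _ => Finset.sum_comm
      _ = ∑ j, ∑ k, ∑ l, (b k l * (4 * a k j)) • (g j * g l) := Finset.sum_comm
      _ = _ := by
        refine Finset.sum_congr rfl fun j _ => ?_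
        rw [Finset.sum_comm]
        refine Finset.sum_congr rfl fun l _ => ?_
        rw [← Finset.sum_smul, Finset.mul_sum]
        congr 1
        refine Finset.sum_congr rfl fun k _ => ?_
        rw [ha k j]; ring
  have e2 : ∑ k, ∑ l, b k l • (g k * ∑ j, (4 * a l j) • g j) =
      ∑ i, ∑ j, (4 * ∑ m, b i m * a m j) • (g i * g j) := by
    simp only [Finset.mul_sum, Finset.smul_sum, mul_smul_comm, smul_smul, Finset.sum_smul]
    refine Finset.sum_congr rfl fun k _ => ?_
    rw [Finset.sum_comm]
    refine Finset.sum_congr rfl fun l _ => Finset.sum_congr rfl fun m _ => ?_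
    congr 1; ring
  simp only [smul_mul_assoc, mul_smul_comm, ← smul_sub]
  rw [e]
  simp only [key, smul_add, Finset.sum_add_distrib]
  rw [e1, e2]
  simp only [Finset.smul_sum, smul_smul, ← Finset.sum_add_distrib, ← add_smul]
  refine Finset.sum_congr rfl fun i _ => Finset.sum_congr rfl fun j _ => ?_
  congr 1
  simp only [Finset.sum_sub_distrib, Finset.sum_neg_distrib]
  ring

/-- The square of a product of `r` anticommuting square roots of `-1`. -/
lemma prod_ofFn_sq : ∀ {r : ℕ} {g : Fin r → 𝒜}
    (_ : ∀ i j, g i * g j + g j * g i = (if i = j then -2 else 0 : ℂ) • 1),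
    (List.ofFn g).prod * (List.ofFn g).prod = (-1 : ℂ) ^ (r * (r + 1) / 2) • 1
  | 0, _, _ => by simp
  | r + 1, g, hg => by
    have hanti : ∀ i j, i ≠ j → g i * g j = -(g j * g i) := fun i j hij => by
      have := hg i j
      rwa [if_neg hij, zero_smul, add_eq_zero_iff_eq_neg] at this
    have hsq : g 0 * g 0 = -1 := by
      have := hg 0 0
      rw [if_pos rfl, ← two_smul ℂ (g 0 * g 0)] at this
      have h2 := congrArg (fun X => (1 / 2 : ℂ) • X) this
      simp only [smul_smul] at h2
      norm_num at h2
      exact h2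
    -- moving `g 0` past a product of `s` further elements gives the sign `(-1) ^ s`
    have hmove : ∀ {s : ℕ} (t : Fin s → Fin (r + 1)), (∀ i, t i ≠ 0) →
        (List.ofFn fun i => g (t i)).prod * g 0 =
          (-1 : ℂ) ^ s • (g 0 * (List.ofFn fun i => g (t i)).prod) := by
      intro s
      induction s with
      | zero => intro t _; simp
      | succ s ih =>
        intro t ht
        rw [List.ofFn_succ, List.prod_cons, mul_assoc, ih (fun i => t i.succ) (fun i => ht _),
          mul_smul_comm, ← mul_assoc, hanti _ _ (ht 0), pow_succ]
        simp [mul_assoc]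
    have ih := prod_ofFn_sq (g := fun i : Fin r => g i.succ) (fun i j => by
      rw [hg]; simp [Fin.succ_inj])
    rw [List.ofFn_succ, List.prod_cons, mul_assoc, ← mul_assoc _ (g 0),
      hmove Fin.succ (fun i => Fin.succ_ne_zero i), smul_mul_assoc, mul_smul_comm, mul_assoc, ih,
      ← mul_assoc, hsq, mul_smul_comm, mul_one, smul_neg, smul_neg, smul_smul, ← neg_smul]
    congr 1
    have e : (r + 1) * (r + 1 + 1) / 2 = r * (r + 1) / 2 + (r + 1) := by
      have : (r + 1) * (r + 1 + 1) = r * (r + 1) + (r + 1) * 2 := by ring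
      rw [this, Nat.add_mul_div_right _ _ (by norm_num)]
    rw [e, pow_add, pow_succ]; ring

/-- The algebraic form of the formula for the curvature endomorphism: `M` are orthonormal tangent
vectors, `C i p` is Clifford multiplication by `II(e_i, e_p)` and `h i p` its square length, `Om` is
the Kähler form of the tangent bundle, `K / 2` the Clifford action of that of the normal bundle, and
`R` is the spinor curvature given by the Ricci equation. -/
lemma sum_curvature {ℬ 𝒞 : Type*} [Ring ℬ] [Algebra ℂ ℬ] [AddCommGroup 𝒞] [Module ℂ 𝒞]
    (β : 𝒜 →ₗ[ℂ] ℬ →ₗ[ℂ] 𝒞) {r : ℕ} {M : Fin r → 𝒜} {C : Fin r → Fin r → ℬ} {K : ℬ}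
    {Om h : Fin r → Fin r → ℂ} {R : Fin r → Fin r → ℬ}
    (hM : ∀ i j, M i * M j + M j * M i = (if i = j then -2 else 0 : ℂ) • 1)
    (hC : ∀ i p, C i p * C i p = -h i p • 1)
    (hR : ∀ i j, R i j = (1 / 4 : ℂ) • ∑ p, (C j p * C i p - C i p * C j p)
      - (Om i j / 2) • K) :
    (2 : ℂ) • ∑ i, ∑ j, β (M i * M j) (R i j) =
      -(∑ i, ∑ j, Om i j • β (M i * M j) K) - ∑ i, ∑ j, ∑ p, β (M i * M j) (C i p * C j p)
        + (∑ i, ∑ p, h i p) • β 1 1 := by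
  have hM' : ∀ i j, M j * M i = (if i = j then -2 else 0 : ℂ) • 1 - M i * M j := fun i j => by
    rw [← hM]; abel
  -- exchanging `i` and `j` and anticommuting `M i` past `M j` leaves a scalar diagonal term
  have e1 : ∑ i, ∑ j, ∑ p, β (M i * M j) (C j p * C i p) =
      (2 : ℂ) • (∑ i, ∑ p, h i p) • β 1 1 - ∑ i, ∑ j, ∑ p, β (M i * M j) (C i p * C j p) := by
    rw [Finset.sum_comm, Finset.sum_congr rfl fun i _ => Finset.sum_congr rfl fun j _ =>
      Finset.sum_congr rfl fun p _ => by rw [hM' i j]]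
    simp only [map_sub, LinearMap.sub_apply, Finset.sum_sub_distrib]
    congr 1
    simp only [ite_smul, zero_smul, Finset.smul_sum, Finset.sum_smul]
    refine Finset.sum_congr rfl fun i _ => ?_
    rw [Finset.sum_eq_single i]
    · refine Finset.sum_congr rfl fun p _ => ?_
      rw [if_pos rfl, hC]
      simp only [map_smul, LinearMap.smul_apply, smul_smul]
      congr 1; ring
    · intro j _ hj
      simp [Ne.symm hj]
    · simp
  simp only [hR, map_sub, map_smul, map_sum, smul_sub, Finset.sum_sub_distrib, ← Finset.smul_sum,
    e1]
  simp only [Finset.smul_sum, smul_smul]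
  have e2 : ∀ i j, 2 * (Om i j / 2) = Om i j := fun i j => by ring
  simp only [e2]
  simp only [← Finset.smul_sum]
  module

end CliffordIdentities

namespace SpinorModule

variable {m : ℕ} {S : Type*} [NormedAddCommGroup S] [InnerProductSpace ℂ S] (c : SpinorModule m S)

lemma cl_mul_self (v : EuclideanSpace ℝ (Fin (2 * m))) :
    c.cl v * c.cl v = ((-‖v‖ ^ 2 : ℝ) : ℂ) • 1 := by
  ext s
  simp [mul_apply_eq_comp, c.cl_sq]

lemma cl_smul (r : ℝ) (v : EuclideanSpace ℝ (Fin (2 * m))) : c.cl (r • v) = (r : ℂ) • c.cl v := by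
  rw [map_smul]
  ext s
  simp

lemma cl_anticomm (v w : EuclideanSpace ℝ (Fin (2 * m))) :
    c.cl v * c.cl w + c.cl w * c.cl v = ((-2 * inner ℝ v w : ℝ) : ℂ) • 1 := by
  have h1 := c.cl_mul_self (v + w)
  have h2 := c.cl_mul_self v
  have h3 := c.cl_mul_self w
  have e : c.cl v * c.cl w + c.cl w * c.cl v =
      (c.cl v + c.cl w) * (c.cl v + c.cl w) - c.cl v * c.cl v - c.cl w * c.cl w := by
    noncomm_ring
  rw [e, ← map_add, h1, h2, h3, ← sub_smul, ← sub_smul, @norm_add_sq_real]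
  congr 1
  push_cast
  ring

lemma cl_stdVec_anticomm (i j : Fin (2 * m)) :
    c.cl (stdVec i) * c.cl (stdVec j) + c.cl (stdVec j) * c.cl (stdVec i) =
      (if i = j then -2 else 0 : ℂ) • 1 := by
  rw [cl_anticomm]
  congr 1
  simp only [stdVec, EuclideanSpace.inner_single_left, PiLp.single_apply]
  split_ifs <;> simp

lemma volume_mul_self : c.volume * c.volume = 1 := by
  rw [volume, smul_mul_assoc, mul_smul_comm, prod_ofFn_sq c.cl_stdVec_anticomm, smul_smul,
    smul_smul, ← mul_pow, Complex.I_mul_I]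
  have e : 2 * m * (2 * m + 1) / 2 = m * (2 * m + 1) := by
    rw [mul_assoc]; exact Nat.mul_div_cancel_left _ (by norm_num)
  rw [e, mul_comm m, pow_mul, ← mul_pow, Odd.neg_one_pow ⟨m, rfl⟩]
  simp

end SpinorModule

/-! ### Derivatives in the coordinates of a chart -/

section Chart

variable {k : ℕ} {M : Type*} [TopologicalSpace M] [ChartedSpace (EuclideanSpace ℝ (Fin k)) M]
  {H : Type*}

/-- The coordinate expression of a map in the chart at `x`. -/
def coordExpr (x : M) (g : M → H) : EuclideanSpace ℝ (Fin k) → H :=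
  g ∘ (extChartAt (𝓡 k) x).symm

/-- The coordinates of `y` in the chart at `x`. -/
def chartPt (x y : M) : EuclideanSpace ℝ (Fin k) := extChartAt (𝓡 k) x y

lemma symm_chartPt (x : M) : (extChartAt (𝓡 k) x).symm (chartPt (k := k) x x) = x :=
  extChartAt_to_inv x

lemma coordExpr_chartPt {x y : M} (hy : y ∈ (chartAt (EuclideanSpace ℝ (Fin k)) x).source)
    (g : M → H) : coordExpr (k := k) x g (chartPt x y) = g y := by
  unfold coordExpr chartPt
  simp only [Function.comp]
  rw [(extChartAt (𝓡 k) x).left_inv (by rwa [extChartAt_source])]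

lemma eventually_chartPt {x : M} {p : M → Prop} (h : ∀ᶠ y in 𝓝 x, p y) :
    ∀ᶠ u in 𝓝 (chartPt (k := k) x x), ∃ y, p y ∧
      y ∈ (chartAt (EuclideanSpace ℝ (Fin k)) x).source ∧ chartPt x y = u := by
  have hc := (continuousAt_extChartAt_symm (I := 𝓡 k) x)
  have e : (extChartAt (𝓡 k) x).symm (extChartAt (𝓡 k) x x) = x := extChartAt_to_inv x
  have h' : ∀ᶠ u in 𝓝 (extChartAt (𝓡 k) x x), p ((extChartAt (𝓡 k) x).symm u) :=
    hc.eventually (by rwa [e])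
  filter_upwards [h', (isOpen_extChartAt_target (I := 𝓡 k) x).mem_nhds
    (mem_extChartAt_target x)] with u hu ht
  refine ⟨_, hu, ?_, (extChartAt (𝓡 k) x).right_inv ht⟩
  rw [← extChartAt_source (𝓡 k)]
  exact (extChartAt (𝓡 k) x).map_target ht

variable [IsManifold (𝓡 k) ∞ M] [NormedAddCommGroup H] [NormedSpace ℝ H]

/-- At the centre of the chart, the tangent space of the manifold is that of the model. -/
lemma mfderiv_eq_fderiv_chart {x : M} {g : M → H} {G : EuclideanSpace ℝ (Fin k) → H}
    (hG : DifferentiableAt ℝ G (chartPt x x)) (hg : ∀ᶠ y in 𝓝 x, g y = G (chartPt x y))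
    (v : TangentSpace (𝓡 k) x) :
    mfderiv (𝓡 k) 𝓘(ℝ, H) g x v = fderiv ℝ G (chartPt x x) v := by
  have h1 : MDifferentiableAt (𝓡 k) 𝓘(ℝ, H) (fun y => G (chartPt x y)) x :=
    MDifferentiableAt.comp (I' := 𝓘(ℝ, EuclideanSpace ℝ (Fin k))) x hG.mdifferentiableAt
      (mdifferentiableAt_extChartAt (mem_chart_source _ x))
  have h2 : g =ᶠ[𝓝 x] fun y => G (chartPt x y) := hg
  rw [h2.mfderiv_eq, h1.mfderiv]
  have h3 : writtenInExtChartAt (𝓡 k) 𝓘(ℝ, H) x (fun y => G (chartPt x y))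
      =ᶠ[𝓝 (chartPt x x)] G := by
    filter_upwards [(isOpen_extChartAt_target (I := 𝓡 k) x).mem_nhds
      (mem_extChartAt_target x)] with u hu
    simp only [writtenInExtChartAt, extChartAt_model_space_eq_id, Function.comp]
    exact congrArg G ((extChartAt (𝓡 k) x).right_inv hu)
  have h4 : Set.range (𝓡 k) = Set.univ := ModelWithCorners.range_eq_univ _
  rw [h4, fderivWithin_univ]
  exact congrArg (fun L : EuclideanSpace ℝ (Fin k) →L[ℝ] H => L v) h3.fderiv_eq

lemma contDiffAt_coordExpr {x : M} {U : Set M} (hU : IsOpen U) {g : M → H}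
    (hg : ContMDiffOn (𝓡 k) 𝓘(ℝ, H) ∞ g U) {y : M} (hyU : y ∈ U)
    (hy : y ∈ (chartAt (EuclideanSpace ℝ (Fin k)) x).source) :
    ContDiffAt ℝ ∞ (coordExpr (k := k) x g) (chartPt x y) := by
  have hy' : y ∈ (extChartAt (𝓡 k) x).source := by rwa [extChartAt_source]
  have ht : chartPt x y ∈ (extChartAt (𝓡 k) x).target := (extChartAt (𝓡 k) x).map_source hy'
  have h1 : ContMDiffAt 𝓘(ℝ, EuclideanSpace ℝ (Fin k)) (𝓡 k) ∞ (extChartAt (𝓡 k) x).symm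
      (chartPt x y) :=
    (contMDiffOn_extChartAt_symm x).contMDiffAt ((isOpen_extChartAt_target x).mem_nhds ht)
  have h2 : ContMDiffAt (𝓡 k) 𝓘(ℝ, H) ∞ g ((extChartAt (𝓡 k) x).symm (chartPt x y)) := by
    rw [show (extChartAt (𝓡 k) x).symm (chartPt x y) = y from (extChartAt (𝓡 k) x).left_inv hy']
    exact hg.contMDiffAt (hU.mem_nhds hyU)
  exact (h2.comp _ h1).contDiffAt

/-- Derivatives along the coordinate fields are derivatives of the coordinate expression. -/
lemma mfderiv_coordField {x y : M} (hy : y ∈ (chartAt (EuclideanSpace ℝ (Fin k)) x).source)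
    {g : M → H} (hg : MDifferentiableAt (𝓡 k) 𝓘(ℝ, H) g y) (w : TangentSpace (𝓡 k) x) :
    mfderiv (𝓡 k) 𝓘(ℝ, H) g y (coordField x w y) = fderiv ℝ (coordExpr x g) (chartPt x y) w := by
  have hy' : y ∈ (extChartAt (𝓡 k) x).source := by rwa [extChartAt_source]
  have ht : extChartAt (𝓡 k) x y ∈ (extChartAt (𝓡 k) x).target :=
    (extChartAt (𝓡 k) x).map_source hy'
  have h4 : Set.range (𝓡 k) = Set.univ := ModelWithCorners.range_eq_univ _
  have e : (extChartAt (𝓡 k) x).symm (extChartAt (𝓡 k) x y) = y :=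
    (extChartAt (𝓡 k) x).left_inv hy'
  have h1 : MDifferentiableAt 𝓘(ℝ, EuclideanSpace ℝ (Fin k)) (𝓡 k) (extChartAt (𝓡 k) x).symm
      (extChartAt (𝓡 k) x y) :=
    (mdifferentiableOn_extChartAt_symm (I := 𝓡 k) (x := x) _ ht).mdifferentiableAt
      ((isOpen_extChartAt_target x).mem_nhds ht)
  unfold coordField
  rw [TangentBundle.symmL_trivializationAt hy, h4, mfderivWithin_univ]
  have h5 := mfderiv_comp_apply_of_eq (x := extChartAt (𝓡 k) x y) (hy := e) hg h1 w
  rw [mfderiv_eq_fderiv] at h5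
  exact h5.symm

end Chart

/-! ### Differentiation of products of endomorphisms -/

/-- Composition of endomorphisms as a continuous real bilinear map. -/
def opMul (n : ℕ) : Op n →L[ℝ] Op n →L[ℝ] Op n :=
  (LinearMap.mk₂ ℝ (fun A B : Op n => A * B) add_mul
    (fun c A B => smul_mul_assoc (c : ℂ) A B) mul_add
    (fun c A B => mul_smul_comm (c : ℂ) A B)).toContinuousBilinearMap

/-- The adjoint as a continuous real linear map. -/
def opAdjoint (n : ℕ) : Op n →L[ℝ] Op n :=
  LinearMap.toContinuousLinearMap
    { toFun := fun A => adjoint A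
      map_add' := fun A B => map_add _ A B
      map_smul' := fun c A => by
        have h : adjoint ((c : ℂ) • A) = (c : ℂ) • adjoint A := by
          rw [map_smulₛₗ, Complex.conj_ofReal]
        exact h }

section Products

variable {E : Type*} [NormedAddCommGroup E] [NormedSpace ℝ E] {F G : E → Op n} {u : E}

lemma differentiableAt_gFS (hF : DifferentiableAt ℝ F u) (hG : DifferentiableAt ℝ G u) :
    DifferentiableAt ℝ (fun y => gFS (F y) (G y)) u :=
  ((gForm n).hasFDerivAt_of_bilinear hF.hasFDerivAt hG.hasFDerivAt).differentiableAt

lemma fderiv_gFS (hF : DifferentiableAt ℝ F u) (hG : DifferentiableAt ℝ G u) (v : E) :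
    fderiv ℝ (fun y => gFS (F y) (G y)) u v =
      gFS (F u) (fderiv ℝ G u v) + gFS (fderiv ℝ F u v) (G u) := by
  have h := ((gForm n).hasFDerivAt_of_bilinear hF.hasFDerivAt hG.hasFDerivAt).fderiv
  exact congrArg (fun L : E →L[ℝ] ℝ => L v) h

lemma gFS_fderiv_of_eventually_const (hF : DifferentiableAt ℝ F u) (hG : DifferentiableAt ℝ G u)
    {c : ℝ} (h : ∀ᶠ y in 𝓝 u, gFS (F y) (G y) = c) (v : E) :
    gFS (fderiv ℝ F u v) (G u) = -gFS (fderiv ℝ G u v) (F u) := by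
  have h1 : (fun y => gFS (F y) (G y)) =ᶠ[𝓝 u] fun _ => c := h
  have h2 := fderiv_gFS hF hG v
  rw [h1.fderiv_eq, fderiv_fun_const, gFS_comm (F u)] at h2
  exact eq_neg_of_add_eq_zero_right h2.symm

lemma differentiableAt_opMul (hF : DifferentiableAt ℝ F u) (hG : DifferentiableAt ℝ G u) :
    DifferentiableAt ℝ (fun y => F y * G y) u :=
  ((opMul n).hasFDerivAt_of_bilinear hF.hasFDerivAt hG.hasFDerivAt).differentiableAt

lemma fderiv_opMul (hF : DifferentiableAt ℝ F u) (hG : DifferentiableAt ℝ G u) (v : E) :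
    fderiv ℝ (fun y => F y * G y) u v = F u * fderiv ℝ G u v + fderiv ℝ F u v * G u := by
  have h := ((opMul n).hasFDerivAt_of_bilinear hF.hasFDerivAt hG.hasFDerivAt).fderiv
  exact congrArg (fun L : E →L[ℝ] Op n => L v) h

lemma adjoint_fderiv (hF : DifferentiableAt ℝ F u) (h : ∀ᶠ y in 𝓝 u, adjoint (F y) = F y) (v : E) :
    adjoint (fderiv ℝ F u v) = fderiv ℝ F u v := by
  have h1 := ((opAdjoint n).hasFDerivAt.comp u hF.hasFDerivAt).fderiv
  have h2 : (opAdjoint n) ∘ F =ᶠ[𝓝 u] F := h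
  rw [h2.fderiv_eq] at h1
  exact (congrArg (fun L : E →L[ℝ] Op n => L v) h1).symm

/-- The derivative of a map into `ℂPⁿ` is tangent to `ℂPⁿ`. -/
lemma fderiv_proj_mem {c : E → CP n} (hc : DifferentiableAt ℝ (fun y => proj (c y)) u) (v : E) :
    fderiv ℝ (fun y => proj (c y)) u v ∈ tangentCP (c u) := by
  refine mem_tangentCP.2 ⟨adjoint_fderiv hc (.of_forall fun y => adjoint_proj _) v, ?_⟩
  have h := fderiv_opMul hc hc v
  simp only [proj_mul_self] at h
  conv_rhs => rw [h]
  exact add_comm _ _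

/-- The derivative of a vector field along `c` tangent to `ℂPⁿ`. -/
lemma fderiv_tangent {c : E → CP n} (hc : DifferentiableAt ℝ (fun y => proj (c y)) u)
    (hF : DifferentiableAt ℝ F u) (h : ∀ᶠ y in 𝓝 u, F y ∈ tangentCP (c y)) (v : E) :
    fderiv ℝ F u v * proj (c u) + F u * fderiv ℝ (fun y => proj (c y)) u v +
      (proj (c u) * fderiv ℝ F u v + fderiv ℝ (fun y => proj (c y)) u v * F u) =
      fderiv ℝ F u v := by
  have e : (fun y => F y * proj (c y) + proj (c y) * F y) =ᶠ[𝓝 u] F :=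
    h.mono fun y hy => (mem_tangentCP.1 hy).2
  have h1 := congrArg (fun L : E →L[ℝ] Op n => L v) e.fderiv_eq
  rw [fderiv_fun_add (differentiableAt_opMul hF hc) (differentiableAt_opMul hc hF), add_apply,
    fderiv_opMul hF hc, fderiv_opMul hc hF] at h1
  rw [← add_comm (F u * _)]
  exact h1

end Products

/-! ### The spin representation of skew matrices -/

/-- The action `¼ ∑ a_{ij} e_i · e_j ·` of a matrix on spinors. On skew matrices it is the
differential of the spin representation. -/
def SpinorModule.bivector {m : ℕ} {S : Type*} [NormedAddCommGroup S] [InnerProductSpace ℂ S]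
    (c : SpinorModule m S) : (Fin (2 * m) → Fin (2 * m) → ℝ) →ₗ[ℝ] (S →L[ℂ] S) where
  toFun a := (1 / 4 : ℂ) • ∑ i, ∑ j, (a i j : ℂ) • (c.cl (stdVec i) * c.cl (stdVec j))
  map_add' a b := by
    simp only [Pi.add_apply, Complex.ofReal_add, add_smul, Finset.sum_add_distrib, smul_add]
  map_smul' r a := by
    have h : ∀ T : S →L[ℂ] S, r • T = (r : ℂ) • T := fun T => by ext s; simp
    simp only [Pi.smul_apply, smul_eq_mul, Complex.ofReal_mul, RingHom.id_apply, h,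
      Finset.smul_sum, smul_smul]
    refine Finset.sum_congr rfl fun i _ => Finset.sum_congr rfl fun j _ => ?_
    congr 1; ring

lemma SpinorModule.bivector_apply {m : ℕ} {S : Type*} [NormedAddCommGroup S]
    [InnerProductSpace ℂ S] (c : SpinorModule m S) (a : Fin (2 * m) → Fin (2 * m) → ℝ) :
    c.bivector a = (1 / 4 : ℂ) • ∑ i, ∑ j, (a i j : ℂ) • (c.cl (stdVec i) * c.cl (stdVec j)) := rfl

lemma SpinorModule.bivector_mul_sub {m : ℕ} {S : Type*} [NormedAddCommGroup S]
    [InnerProductSpace ℂ S] (c : SpinorModule m S) {a b : Fin (2 * m) → Fin (2 * m) → ℝ}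
    (ha : ∀ i j, a i j = -a j i) :
    c.bivector a * c.bivector b - c.bivector b * c.bivector a =
      c.bivector fun i j => ∑ m, (b i m * a m j - a i m * b m j) := by
  simp only [bivector_apply]
  rw [bivector_commutator c.cl_stdVec_anticomm (fun i j => by rw [ha i j]; push_cast; rfl)]
  push_cast
  rfl

section Frames

variable {k q : ℕ} {M : Type*} [TopologicalSpace M] [ChartedSpace (EuclideanSpace ℝ (Fin k)) M]
  {f : M → CP n} {ιN : Type*} (σ : SpinStructure (k := k) (normalM (k := k) f) (2 * q) ιN)

/-- The derivative at `x` of the `i`-th member of a normal frame, as an endomorphism of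
`ℂ^{n+1}`: the flat derivative, without projection to the normal bundle. -/
def frameDeriv (b : ιN) (x : M) (i : Fin (2 * q)) (v : TangentSpace (𝓡 k) x) : Op n :=
  fderiv ℝ (coordExpr x (σ.frame b i)) (chartPt x x) v

lemma frame_mem_normalM {b : ιN} {y : M} (hy : y ∈ σ.U b) (i : Fin (2 * q)) :
    σ.frame b i y ∈ normalM (k := k) f y :=
  σ.span_eq b y hy ▸ Submodule.subset_span ⟨i, rfl⟩

/-- Both projections in the normal connection are invisible to pairings with normal vectors. -/
lemma gFS_orthPart_leviCivita {b : ιN} {y : M} (hy : y ∈ σ.U b) (ν : M → Op n)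
    (v : TangentSpace (𝓡 k) y) (j : Fin (2 * q)) :
    gFS (orthPart (normalM (k := k) f y) (leviCivita f ν y v)) (σ.frame b j y) =
      gFS (mfderiv (𝓡 k) 𝓘(ℝ, Op n) ν y v : Op n) (σ.frame b j y) := by
  rw [orthPart_eq_sum (σ.orthonormal b y hy) (σ.span_eq b y hy)]
  simp only [gFS_sum_left, gFS_smul_left, σ.orthonormal b y hy, mul_ite, mul_one, mul_zero,
    Finset.sum_ite_eq', Finset.mem_univ, if_true]
  exact gFS_tangentPart _ (frame_mem_normalM σ hy j).1

variable {SN : Type*} [NormedAddCommGroup SN] [InnerProductSpace ℂ SN] (c : SpinorModule q SN)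

lemma spinConnForm_eq {b : ιN} {y : M} (hy : y ∈ σ.U b) (v : TangentSpace (𝓡 k) y) :
    spinConnForm σ c b y v = c.bivector fun i j =>
      gFS (mfderiv (𝓡 k) 𝓘(ℝ, Op n) (σ.frame b i) y v : Op n) (σ.frame b j y) := by
  rw [c.bivector_apply]
  unfold spinConnForm
  simp only [normalConn, gFS_orthPart_leviCivita σ hy]

lemma spinCov_one {b : ιN} {y : M} (v : TangentSpace (𝓡 k) y) :
    spinCov σ c b (fun _ => 1) y v = spinConnForm σ c b y v := by
  unfold spinCov
  rw [mfderiv_const, mul_one]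
  exact zero_add _

variable [IsManifold (𝓡 k) ∞ M]

variable {σ} in
lemma differentiableAt_frame {b : ιN} {x : M} (hx : x ∈ σ.U b) (i : Fin (2 * q)) :
    DifferentiableAt ℝ (coordExpr (k := k) x (σ.frame b i)) (chartPt x x) :=
  (contDiffAt_coordExpr (σ.isOpen_U b) (σ.smooth_frame b i) hx
    (mem_chart_source _ x)).differentiableAt (by simp)

lemma frameDeriv_skew {b : ιN} {x : M} (hx : x ∈ σ.U b) (v : TangentSpace (𝓡 k) x)
    (i j : Fin (2 * q)) : gFS (frameDeriv σ b x i v) (σ.frame b j x) =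
      -gFS (frameDeriv σ b x j v) (σ.frame b i x) := by
  have hsrc : x ∈ (chartAt (EuclideanSpace ℝ (Fin k)) x).source := mem_chart_source _ x
  have hconst : ∀ᶠ u in 𝓝 (chartPt (k := k) x x), gFS (coordExpr x (σ.frame b i) u)
      (coordExpr x (σ.frame b j) u) = if i = j then 1 else 0 := by
    filter_upwards [eventually_chartPt (k := k) ((σ.isOpen_U b).mem_nhds hx)] with u hu
    obtain ⟨y, hy, hys, rfl⟩ := hu
    simp only [coordExpr_chartPt hys]
    exact σ.orthonormal b y hy i j
  have h := gFS_fderiv_of_eventually_const (differentiableAt_frame hx i)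
    (differentiableAt_frame hx j) hconst v
  rw [coordExpr_chartPt hsrc, coordExpr_chartPt hsrc] at h
  exact h

/-- The curvature of `ΣN` in terms of the derivatives of a normal frame. -/
lemma spinCurv_eq {b : ιN} {x : M} (hx : x ∈ σ.U b) (v w : TangentSpace (𝓡 k) x) :
    spinCurv σ c b x v w = c.bivector fun i j =>
      gFS (frameDeriv σ b x i w) (frameDeriv σ b x j v) -
        gFS (frameDeriv σ b x i v) (frameDeriv σ b x j w) +
        ∑ m, (gFS (frameDeriv σ b x i w) (σ.frame b m x) *
            gFS (frameDeriv σ b x m v) (σ.frame b j x) -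
          gFS (frameDeriv σ b x i v) (σ.frame b m x) *
            gFS (frameDeriv σ b x m w) (σ.frame b j x)) := by
  set u₀ : EuclideanSpace ℝ (Fin k) := chartPt x x with hu₀
  set N : Fin (2 * q) → EuclideanSpace ℝ (Fin k) → Op n :=
    fun i => coordExpr x (σ.frame b i) with hN
  have hsrc : x ∈ (chartAt (EuclideanSpace ℝ (Fin k)) x).source := mem_chart_source _ x
  have hNx : ∀ i, N i u₀ = σ.frame b i x := fun i => coordExpr_chartPt hsrc _
  have hsm : ∀ i, ContDiffAt ℝ ∞ (N i) u₀ := fun i =>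
    contDiffAt_coordExpr (σ.isOpen_U b) (σ.smooth_frame b i) hx hsrc
  have hd : ∀ i, DifferentiableAt ℝ (N i) u₀ := fun i => (hsm i).differentiableAt (by simp)
  have hd1 : ∀ i, DifferentiableAt ℝ (fderiv ℝ (N i)) u₀ := fun i =>
    ((hsm i).fderiv_right (m := 1) (by norm_cast)).differentiableAt (by simp)
  have hd2 : ∀ i (w : EuclideanSpace ℝ (Fin k)),
      DifferentiableAt ℝ (fun u => fderiv ℝ (N i) u w) u₀ := fun i w =>
    (hd1 i).clm_apply (differentiableAt_const w)
  have hd2' : ∀ i (v w : EuclideanSpace ℝ (Fin k)),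
      fderiv ℝ (fun u => fderiv ℝ (N i) u w) u₀ v = fderiv ℝ (fderiv ℝ (N i)) u₀ v w := by
    intro i v w
    rw [fderiv_clm_apply (hd1 i) (differentiableAt_const w)]
    simp
  have hsymm : ∀ i (v w : EuclideanSpace ℝ (Fin k)), fderiv ℝ (fderiv ℝ (N i)) u₀ v w =
      fderiv ℝ (fderiv ℝ (N i)) u₀ w v := fun i v w =>
    ((hsm i).isSymmSndFDerivAt (by
      simp only [minSmoothness_of_isRCLikeNormedField]; norm_cast)).eq v w
  -- the connection form in coordinates
  set θ : EuclideanSpace ℝ (Fin k) → EuclideanSpace ℝ (Fin k) → Fin (2 * q) → Fin (2 * q) → ℝ :=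
    fun w u i j => gFS (fderiv ℝ (N i) u w) (N j u) with hθ
  have hθd : ∀ w, DifferentiableAt ℝ (θ w) u₀ := fun w =>
    differentiableAt_pi.2 fun i => differentiableAt_pi.2 fun j =>
      differentiableAt_gFS (hd2 i w) (hd j)
  have hθ' : ∀ v w i j, fderiv ℝ (θ w) u₀ v i j =
      gFS (fderiv ℝ (N i) u₀ w) (fderiv ℝ (N j) u₀ v) +
        gFS (fderiv ℝ (fderiv ℝ (N i)) u₀ v w) (N j u₀) := by
    intro v w i j
    have h1 := differentiableAt_pi.1 (hθd w)
    rw [fderiv_pi h1, ContinuousLinearMap.pi_apply, fderiv_pi (differentiableAt_pi.1 (h1 i)),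
      ContinuousLinearMap.pi_apply, ← hd2']
    exact fderiv_gFS (hd2 i w) (hd j) v
  set Λ : (Fin (2 * q) → Fin (2 * q) → ℝ) →L[ℝ] (SN →L[ℂ] SN) :=
    LinearMap.toContinuousLinearMap c.bivector with hΛ
  have hmd : ∀ y ∈ σ.U b, ∀ i, MDifferentiableAt (𝓡 k) 𝓘(ℝ, Op n) (σ.frame b i) y :=
    fun y hy i => ((σ.smooth_frame b i).contMDiffAt
      ((σ.isOpen_U b).mem_nhds hy)).mdifferentiableAt (by simp)
  have hform : ∀ w : TangentSpace (𝓡 k) x, ∀ᶠ y in 𝓝 x,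
      spinCov σ c b (fun _ => 1) y (coordField x w y) = (fun u => Λ (θ w u)) (chartPt x y) := by
    intro w
    filter_upwards [(σ.isOpen_U b).mem_nhds hx,
      (chartAt (EuclideanSpace ℝ (Fin k)) x).open_source.mem_nhds hsrc] with y hy hys
    rw [spinCov_one, spinConnForm_eq σ c hy]
    refine congrArg c.bivector ?_
    funext i j
    rw [mfderiv_coordField hys (hmd y hy i)]
    simp only [hθ, hN, coordExpr_chartPt hys]
  have hformx : ∀ w : TangentSpace (𝓡 k) x, spinConnForm σ c b x w = Λ (θ w u₀) := by
    intro w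
    rw [spinConnForm_eq σ c hx]
    refine congrArg c.bivector ?_
    funext i j
    rw [mfderiv_eq_fderiv_chart (hd i) (by
      filter_upwards [(chartAt (EuclideanSpace ℝ (Fin k)) x).open_source.mem_nhds hsrc] with y hy
      exact (coordExpr_chartPt hy _).symm)]
    simp only [hθ, hNx]
    rfl
  have hcov : ∀ v w : TangentSpace (𝓡 k) x,
      spinCov σ c b (fun y => spinCov σ c b (fun _ => 1) y (coordField x w y)) x v =
        Λ (fderiv ℝ (θ w) u₀ v) + Λ (θ v u₀) * Λ (θ w u₀) := by
    intro v w
    rw [spinCov, hformx, (hform w).self_of_nhds]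
    congr 1
    have hdΛ : DifferentiableAt ℝ (fun u => Λ (θ w u)) u₀ :=
      Λ.differentiableAt.comp u₀ (hθd w)
    refine (mfderiv_eq_fderiv_chart hdΛ (hform w) v).trans ?_
    have := (Λ.hasFDerivAt.comp u₀ (hθd w).hasFDerivAt).fderiv
    exact congrArg (fun L : EuclideanSpace ℝ (Fin k) →L[ℝ] (SN →L[ℂ] SN) => L v) this
  have hskew : ∀ v i j, θ v u₀ i j = -θ v u₀ j i := by
    intro v i j
    simp only [hθ, hNx]
    exact frameDeriv_skew σ hx v i j
  have hcomm := c.bivector_mul_sub (b := θ w u₀) (hskew v)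
  have e : spinCurv σ c b x v w = c.bivector (fderiv ℝ (θ w) u₀ v) -
      c.bivector (fderiv ℝ (θ v) u₀ w) + (c.bivector (θ v u₀) * c.bivector (θ w u₀) -
        c.bivector (θ w u₀) * c.bivector (θ v u₀)) := by
    rw [spinCurv, hcov, hcov]
    simp only [hΛ, LinearMap.coe_toContinuousLinearMap']
    abel
  rw [e, hcomm, ← map_sub, ← map_add]
  congr 1
  funext i j
  have key : ∀ v w : EuclideanSpace ℝ (Fin k),
      (fderiv ℝ (θ w) u₀ v - fderiv ℝ (θ v) u₀ w +
        fun i j => ∑ m, (θ w u₀ i m * θ v u₀ m j - θ v u₀ i m * θ w u₀ m j)) i j =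
      gFS (fderiv ℝ (N i) u₀ w) (fderiv ℝ (N j) u₀ v) -
        gFS (fderiv ℝ (N i) u₀ v) (fderiv ℝ (N j) u₀ w) +
        ∑ m, (θ w u₀ i m * θ v u₀ m j - θ v u₀ i m * θ w u₀ m j) := by
    intro v w
    simp only [Pi.add_apply, Pi.sub_apply, hθ']
    rw [hsymm i v w]
    ring
  rw [key v w]
  simp only [hθ, hNx]
  rfl

end Frames

/-! ### The Ricci equation -/

section Immersion

variable {k : ℕ} {M : Type*} [TopologicalSpace M] [ChartedSpace (EuclideanSpace ℝ (Fin k)) M]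
  {f : M → CP n}

lemma IsKaehlerImmersion.mdifferentiableAt (hf : IsKaehlerImmersion (k := k) f) (y : M) :
    MDifferentiableAt (𝓡 k) 𝓘(ℝ, Op n) (fun y => proj (f y)) y :=
  (hf.smooth y).mdifferentiableAt (by simp)

lemma span_dF {x : M} {e : Fin k → TangentSpace (𝓡 k) x}
    (he : ∀ i j, gFS (dF f x (e i)) (dF f x (e j)) = if i = j then 1 else 0) :
    Submodule.span ℝ (Set.range fun i => dF f x (e i)) = tangentM (k := k) f x := by
  have : FiniteDimensional ℝ (TangentSpace (𝓡 k) x) :=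
    inferInstanceAs (FiniteDimensional ℝ (EuclideanSpace ℝ (Fin k)))
  refine Submodule.eq_of_le_of_finrank_le (Submodule.span_le.2 ?_) ?_
  · rintro _ ⟨i, rfl⟩; exact ⟨e i, rfl⟩
  · rw [finrank_span_eq_card (linearIndependent_of_gFS he)]
    refine (LinearMap.finrank_range_le _).trans ?_
    have : Module.finrank ℝ (TangentSpace (𝓡 k) x) = k :=
      finrank_euclideanSpace_fin (𝕜 := ℝ) (n := k)
    simp [this]

lemma gFS_normal_tangent {x : M} {A : Op n} (hA : A ∈ normalM (k := k) f x)
    (v : TangentSpace (𝓡 k) x) : gFS A (dF f x v) = 0 :=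
  hA.2 _ ⟨v, rfl⟩

variable {q : ℕ} {ιN : Type*} (σ : SpinStructure (k := k) (normalM (k := k) f) (2 * q) ιN)

lemma eventually_frame_mem {b : ιN} {x : M} (hx : x ∈ σ.U b) (i : Fin (2 * q)) :
    ∀ᶠ u in 𝓝 (chartPt (k := k) x x), coordExpr x (σ.frame b i) u ∈
      tangentCP ((f ∘ (extChartAt (𝓡 k) x).symm) u) := by
  filter_upwards [eventually_chartPt (k := k) ((σ.isOpen_U b).mem_nhds hx)] with u hu
  obtain ⟨y, hy, hys, rfl⟩ := hu
  have e : (extChartAt (𝓡 k) x).symm (chartPt x y) = y :=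
    (extChartAt (𝓡 k) x).left_inv (by rwa [extChartAt_source])
  rw [coordExpr_chartPt hys, Function.comp, e]
  exact (frame_mem_normalM σ hy i).1

variable [IsManifold (𝓡 k) ∞ M]

lemma IsKaehlerImmersion.contDiffAt_coordExpr (hf : IsKaehlerImmersion (k := k) f) (x : M) :
    ContDiffAt ℝ ∞ (coordExpr (k := k) x fun y => proj (f y)) (chartPt x x) :=
  KaehlerSpin.contDiffAt_coordExpr isOpen_univ hf.smooth.contMDiffOn (Set.mem_univ x)
    (mem_chart_source _ x)

lemma IsKaehlerImmersion.dF_eq (hf : IsKaehlerImmersion (k := k) f) (x : M)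
    (v : TangentSpace (𝓡 k) x) :
    dF f x v = fderiv ℝ (coordExpr x fun y => proj (f y)) (chartPt x x) v := by
  refine mfderiv_eq_fderiv_chart ((hf.contDiffAt_coordExpr x).differentiableAt (by simp)) ?_ v
  filter_upwards [(chartAt (EuclideanSpace ℝ (Fin k)) x).open_source.mem_nhds
    (mem_chart_source _ x)] with y hy
  exact (coordExpr_chartPt hy fun y => proj (f y)).symm

lemma IsKaehlerImmersion.dF_mem (hf : IsKaehlerImmersion (k := k) f) (x : M)
    (v : TangentSpace (𝓡 k) x) : dF f x v ∈ tangentCP (f x) := by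
  have h := fderiv_proj_mem (c := f ∘ (extChartAt (𝓡 k) x).symm) (u := chartPt x x)
    ((hf.contDiffAt_coordExpr x).differentiableAt (by simp)) v
  simp only [Function.comp, symm_chartPt] at h
  rw [hf.dF_eq]
  exact h

/-- The tangent component of a self-adjoint endomorphism in terms of orthonormal bases of the
tangent and normal spaces of the submanifold. -/
lemma tangentPart_eq_sum (hf : IsKaehlerImmersion (k := k) f) {x : M}
    {e : Fin k → TangentSpace (𝓡 k) x}
    (he : ∀ i j, gFS (dF f x (e i)) (dF f x (e j)) = if i = j then 1 else 0)
    {r : ℕ} {ν : Fin r → Op n} (hν : ∀ i j, gFS (ν i) (ν j) = if i = j then 1 else 0)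
    (hs : Submodule.span ℝ (Set.range ν) = normalM (k := k) f x) {A : Op n} (hA : adjoint A = A) :
    tangentPart (f x) A =
      ∑ p, gFS A (dF f x (e p)) • dF f x (e p) + ∑ m, gFS A (ν m) • ν m := by
  have hνm : ∀ m, ν m ∈ normalM (k := k) f x := fun m => hs ▸ Submodule.subset_span ⟨m, rfl⟩
  set T := tangentPart (f x) A with hT
  have hTm : T ∈ tangentCP (f x) := tangentPart_mem hA
  have h1 : ∀ p, gFS T (dF f x (e p)) = gFS A (dF f x (e p)) := fun p =>
    gFS_tangentPart A (hf.dF_mem x _)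
  have h2 : ∀ m, gFS T (ν m) = gFS A (ν m) := fun m => gFS_tangentPart A (hνm m).1
  have h3 : T - ∑ p, gFS A (dF f x (e p)) • dF f x (e p) ∈ normalM (k := k) f x := by
    refine ⟨sub_mem hTm (Submodule.sum_mem _ fun p _ => Submodule.smul_mem _ _ (hf.dF_mem x _)),
      fun B hB => ?_⟩
    rw [eq_sum_gFS_of_mem_span he (A := B) ((span_dF he).symm ▸ hB)]
    simp [gFS_sub_left, gFS_sum_left, gFS_sum_right, gFS_smul_left, gFS_smul_right, he, h1]
  have h4 := eq_sum_gFS_of_mem_span hν (hs.symm ▸ h3)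
  rw [sub_eq_iff_eq_add'] at h4
  rw [h4]
  congr 1
  refine Finset.sum_congr rfl fun m _ => ?_
  have h5 : ∀ p, gFS (dF f x (e p)) (ν m) = 0 := fun p => by
    rw [gFS_comm]; exact gFS_normal_tangent (hνm m) _
  simp [gFS_sub_left, gFS_sum_left, gFS_smul_left, h5, h2]

lemma gFS_tangentPart_tangentPart (hf : IsKaehlerImmersion (k := k) f) {x : M}
    {e : Fin k → TangentSpace (𝓡 k) x}
    (he : ∀ i j, gFS (dF f x (e i)) (dF f x (e j)) = if i = j then 1 else 0)
    {r : ℕ} {ν : Fin r → Op n} (hν : ∀ i j, gFS (ν i) (ν j) = if i = j then 1 else 0)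
    (hs : Submodule.span ℝ (Set.range ν) = normalM (k := k) f x) (A : Op n) {B : Op n}
    (hB : adjoint B = B) :
    gFS (tangentPart (f x) A) (tangentPart (f x) B) =
      ∑ p, gFS A (dF f x (e p)) * gFS B (dF f x (e p)) + ∑ m, gFS A (ν m) * gFS B (ν m) := by
  have hνm : ∀ m, ν m ∈ normalM (k := k) f x := fun m => hs ▸ Submodule.subset_span ⟨m, rfl⟩
  rw [tangentPart_eq_sum hf he hν hs hB, ← gForm_apply, map_add]
  simp only [gForm_apply, gFS_sum_right, gFS_smul_right]
  congr 1
  · exact Finset.sum_congr rfl fun p _ => by rw [gFS_tangentPart A (hf.dF_mem x _), mul_comm]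
  · exact Finset.sum_congr rfl fun m _ => by rw [gFS_tangentPart A (hνm m).1, mul_comm]

lemma adjoint_frameDeriv {b : ιN} {x : M} (hx : x ∈ σ.U b) (i : Fin (2 * q))
    (v : TangentSpace (𝓡 k) x) : adjoint (frameDeriv σ b x i v) = frameDeriv σ b x i v :=
  adjoint_fderiv (differentiableAt_frame hx i)
    ((eventually_frame_mem σ hx i).mono fun _ hu => hu.1) v

lemma frameDeriv_sub_tangentPart (hf : IsKaehlerImmersion (k := k) f) {b : ιN} {x : M}
    (hx : x ∈ σ.U b) (i : Fin (2 * q)) (v : TangentSpace (𝓡 k) x) :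
    frameDeriv σ b x i v - tangentPart (f x) (frameDeriv σ b x i v) =
      (1 - (proj (f x) + proj (f x))) *
        (σ.frame b i x * dF f x v + dF f x v * σ.frame b i x) := by
  refine sub_tangentPart_of_deriv ?_
  have h := fderiv_tangent (c := f ∘ (extChartAt (𝓡 k) x).symm)
    ((hf.contDiffAt_coordExpr x).differentiableAt (by simp)) (differentiableAt_frame hx i)
    (eventually_frame_mem σ hx i) v
  rw [coordExpr_chartPt (mem_chart_source _ x)] at h
  rw [hf.dF_eq]
  simp only [Function.comp, symm_chartPt] at h
  exact h

/-- The Weingarten equation. -/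
lemma gFS_II_frame (hf : IsKaehlerImmersion (k := k) f) {b : ιN} {x : M} (hx : x ∈ σ.U b)
    (v w : TangentSpace (𝓡 k) x) (j : Fin (2 * q)) :
    gFS (II f x v w) (σ.frame b j x) = -gFS (frameDeriv σ b x j v) (dF f x w) := by
  set u₀ : EuclideanSpace ℝ (Fin k) := chartPt x x with hu₀
  set F : EuclideanSpace ℝ (Fin k) → Op n := coordExpr x fun y => proj (f y) with hF
  have hsrc : x ∈ (chartAt (EuclideanSpace ℝ (Fin k)) x).source := mem_chart_source _ x
  have hd : DifferentiableAt ℝ (fun u => fderiv ℝ F u w) u₀ :=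
    (((hf.contDiffAt_coordExpr x).fderiv_right (m := 1) (by norm_cast)).differentiableAt
      (by simp)).clm_apply (differentiableAt_const _)
  have hdF : ∀ y ∈ (chartAt (EuclideanSpace ℝ (Fin k)) x).source,
      dF f y (coordField x w y) = fderiv ℝ F (chartPt x y) w := fun y hy =>
    mfderiv_coordField hy (hf.mdifferentiableAt y) w
  unfold II
  rw [gFS_orthPart_leviCivita σ hx, mfderiv_eq_fderiv_chart hd (by
    filter_upwards [(chartAt (EuclideanSpace ℝ (Fin k)) x).open_source.mem_nhds hsrc] with y hy
    exact hdF y hy)]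
  have hzero : ∀ᶠ u in 𝓝 u₀, gFS (fderiv ℝ F u w) (coordExpr x (σ.frame b j) u) = 0 := by
    filter_upwards [eventually_chartPt (k := k) ((σ.isOpen_U b).mem_nhds hx)] with u hu
    obtain ⟨y, hy, hys, rfl⟩ := hu
    rw [coordExpr_chartPt hys, ← hdF y hys, gFS_comm]
    exact gFS_normal_tangent (frame_mem_normalM σ hy j) _
  have h := gFS_fderiv_of_eventually_const hd (differentiableAt_frame hx j) hzero v
  rw [coordExpr_chartPt hsrc, ← hf.dF_eq] at h
  exact h

lemma II_eq_sum {b : ιN} {x : M} (hx : x ∈ σ.U b) (v w : TangentSpace (𝓡 k) x) :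
    II f x v w = ∑ m, gFS (II f x v w) (σ.frame b m x) • σ.frame b m x := by
  have h := orthPart_eq_sum (σ.orthonormal b x hx) (σ.span_eq b x hx)
    (leviCivita f (fun y => dF f y (coordField x w y)) x v)
  change II f x v w = _ at h
  conv_lhs => rw [h]
  refine Finset.sum_congr rfl fun m _ => ?_
  rw [h]
  simp [gFS_sum_left, gFS_smul_left, σ.orthonormal b x hx]

/-- The Ricci equation: the curvature matrix of the normal bundle of a Kähler submanifold of
`ℂPⁿ` in an orthonormal frame. -/
lemma ricci_equation (hf : IsKaehlerImmersion (k := k) f) {b : ιN} {x : M} (hx : x ∈ σ.U b)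
    {e : Fin k → TangentSpace (𝓡 k) x}
    (he : ∀ i j, gFS (dF f x (e i)) (dF f x (e j)) = if i = j then 1 else 0)
    (v w : TangentSpace (𝓡 k) x) (i j : Fin (2 * q)) :
    gFS (frameDeriv σ b x i w) (frameDeriv σ b x j v) -
        gFS (frameDeriv σ b x i v) (frameDeriv σ b x j w) =
      ∑ p, (gFS (II f x w (e p)) (σ.frame b i x) * gFS (II f x v (e p)) (σ.frame b j x) -
        gFS (II f x v (e p)) (σ.frame b i x) * gFS (II f x w (e p)) (σ.frame b j x)) +
      ∑ m, (gFS (frameDeriv σ b x i w) (σ.frame b m x) * gFS (frameDeriv σ b x j v) (σ.frame b m x)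
        - gFS (frameDeriv σ b x i v) (σ.frame b m x) * gFS (frameDeriv σ b x j w) (σ.frame b m x))
      - 2 * gFS (cpxJ (f x) (dF f x v)) (dF f x w) *
        gFS (cpxJ (f x) (σ.frame b i x)) (σ.frame b j x) := by
  have key : ∀ v w : TangentSpace (𝓡 k) x,
      gFS (frameDeriv σ b x i w) (frameDeriv σ b x j v) =
      ∑ p, gFS (II f x w (e p)) (σ.frame b i x) * gFS (II f x v (e p)) (σ.frame b j x) +
      ∑ m, gFS (frameDeriv σ b x i w) (σ.frame b m x) * gFS (frameDeriv σ b x j v) (σ.frame b m x)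
      + gFS (σ.frame b i x * dF f x w + dF f x w * σ.frame b i x)
          (σ.frame b j x * dF f x v + dF f x v * σ.frame b j x) := by
    intro v w
    rw [gFS_split (f x), gFS_tangentPart_tangentPart hf he (σ.orthonormal b x hx)
      (σ.span_eq b x hx) _ (adjoint_frameDeriv σ hx j v), frameDeriv_sub_tangentPart σ hf hx,
      frameDeriv_sub_tangentPart σ hf hx,
      gFS_reflection_mul (frame_mem_normalM σ hx i).1 (hf.dF_mem x w)]
    simp only [gFS_II_frame σ hf hx, neg_mul_neg]
  have hstab : ∀ v : TangentSpace (𝓡 k) x, gFS (cpxJ (f x) (dF f x v)) (σ.frame b j x) = 0 := by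
    intro v
    obtain ⟨w, hw⟩ := hf.stable x v
    rw [← hw, gFS_comm]
    exact gFS_normal_tangent (frame_mem_normalM σ hx j) w
  have h := gFS_anticommutators (frame_mem_normalM σ hx i).1 (frame_mem_normalM σ hx j).1
    (hf.dF_mem x v) (hf.dF_mem x w) (gFS_normal_tangent (frame_mem_normalM σ hx j) v) (hstab v)
    (gFS_normal_tangent (frame_mem_normalM σ hx j) w) (hstab w)
  rw [key v w, key w v, Finset.sum_sub_distrib, Finset.sum_sub_distrib]
  linear_combination h

end Immersion

/-! ### The Kähler form as a Clifford element -/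

/-- The complex structure of `ℂPⁿ` as a real linear map. -/
def cpxJLinear (l : CP n) : Op n →ₗ[ℝ] Op n where
  toFun := cpxJ l
  map_add' A B := by
    unfold cpxJ
    refine Eq.trans ?_ (smul_add Complex.I _ _)
    refine congrArg (fun X : Op n => Complex.I • X) ?_
    change (A + B) * proj l - proj l * (A + B) = _ * proj l - proj l * _ + (_ * proj l - proj l * _)
    rw [add_mul, mul_add]; abel
  map_smul' c A := by
    unfold cpxJ
    refine Eq.trans ?_ (smul_comm Complex.I (c : ℂ) _)
    refine congrArg (fun X : Op n => Complex.I • X) ?_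
    refine Eq.trans ?_ (smul_sub (c : ℂ) _ _).symm
    exact congrArg₂ (fun X Y : Op n => X - Y) (smul_mul_assoc (c : ℂ) A (proj l))
      (mul_smul_comm (c : ℂ) (proj l) A)

lemma gFS_cpxJ_sum {ι : Type*} (s : Finset ι) (l : CP n) (r : ι → ℝ) (A : ι → Op n) (B : Op n) :
    gFS (cpxJ l (∑ i ∈ s, r i • A i)) B = ∑ i ∈ s, r i * gFS (cpxJ l (A i)) B := by
  have h : cpxJ l (∑ i ∈ s, r i • A i) = ∑ i ∈ s, r i • cpxJ l (A i) :=
    (map_sum (cpxJLinear l) _ _).trans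
      (Finset.sum_congr rfl fun i _ => map_smul (cpxJLinear l) (r i) (A i))
  rw [h]
  simp only [gFS_sum_left, gFS_smul_left]

/-- The Clifford action of the Kähler form does not depend on the orthonormal basis. -/
lemma kaehlerAction_basis_change {S : Type*} [AddCommGroup S] [Module ℂ S] (l : CP n)
    {cl : Op n → Module.End ℂ S} {r : ℕ}
    (hcl : ∀ (c : Fin r → ℝ) (A : Fin r → Op n), cl (∑ i, c i • A i) = ∑ i, (c i : ℂ) • cl (A i))
    {W : Submodule ℝ (Op n)} {s t : Fin r → Op n}
    (hs : ∀ i j, gFS (s i) (s j) = if i = j then 1 else 0)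
    (hsW : Submodule.span ℝ (Set.range s) = W)
    (ht : ∀ i j, gFS (t i) (t j) = if i = j then 1 else 0)
    (htW : Submodule.span ℝ (Set.range t) = W) :
    kaehlerAction l cl s = kaehlerAction l cl t := by
  have es : ∀ i, s i = ∑ k, gFS (s i) (t k) • t k := fun i =>
    eq_sum_gFS_of_mem_span ht (by rw [htW, ← hsW]; exact Submodule.subset_span ⟨i, rfl⟩)
  have et : ∀ k, t k = ∑ i, gFS (t k) (s i) • s i := fun k =>
    eq_sum_gFS_of_mem_span hs (by rw [hsW, ← htW]; exact Submodule.subset_span ⟨k, rfl⟩)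
  have hc : ∀ i, cl (s i) = ∑ k, (gFS (s i) (t k) : ℂ) • cl (t k) := fun i => by
    conv_lhs => rw [es i]
    exact hcl _ _
  have hJ : ∀ k l', gFS (cpxJ l (t k)) (t l') =
      ∑ i, ∑ j, gFS (cpxJ l (s i)) (s j) * gFS (s i) (t k) * gFS (s j) (t l') := by
    intro k l'
    conv_lhs => rw [et k, gFS_cpxJ_sum, et l']
    refine Finset.sum_congr rfl fun i _ => ?_
    rw [gFS_sum_right, Finset.mul_sum]
    refine Finset.sum_congr rfl fun j _ => ?_
    rw [gFS_smul_right, gFS_comm (t k), gFS_comm (t l')]; ring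
  unfold kaehlerAction
  congr 1
  calc _ = ∑ i, ∑ j, ∑ k, ∑ l', ((gFS (cpxJ l (s i)) (s j) * gFS (s i) (t k) *
            gFS (s j) (t l') : ℝ) : ℂ) • (cl (t k) * cl (t l')) := by
        refine Finset.sum_congr rfl fun i _ => Finset.sum_congr rfl fun j _ => ?_
        rw [hc i, hc j, Finset.sum_mul, Finset.smul_sum]
        refine Finset.sum_congr rfl fun k _ => ?_
        rw [Finset.mul_sum, Finset.smul_sum]
        refine Finset.sum_congr rfl fun l' _ => ?_
        rw [smul_mul_assoc, mul_smul_comm, smul_smul, smul_smul]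
        push_cast
        rw [mul_assoc]
    _ = ∑ k, ∑ l', ∑ i, ∑ j, ((gFS (cpxJ l (s i)) (s j) * gFS (s i) (t k) *
            gFS (s j) (t l') : ℝ) : ℂ) • (cl (t k) * cl (t l')) := by
        rw [Finset.sum_congr rfl fun i _ => Finset.sum_comm, Finset.sum_comm]
        refine Finset.sum_congr rfl fun k _ => ?_
        rw [Finset.sum_congr rfl fun i _ => Finset.sum_comm, Finset.sum_comm]
    _ = _ := by
        refine Finset.sum_congr rfl fun k _ => Finset.sum_congr rfl fun l' _ => ?_
        rw [hJ]
        push_cast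
        simp only [Finset.sum_smul]

/-! ### Clifford multiplication on `ΣM ⊗ ΣN` -/

section Coords

variable {k : ℕ} {M : Type*} [TopologicalSpace M] [ChartedSpace (EuclideanSpace ℝ (Fin k)) M]

section Bundle

variable {W : M → Submodule ℝ (Op n)} {r : ℕ} {ι : Type*} (σ : SpinStructure (k := k) W r ι)
  {a : ι} {x : M}

lemma coords_apply (A : Op n) (i : Fin r) : σ.coords a x A i = gFS A (σ.frame a i x) := by
  simp [SpinStructure.coords, stdVec, Pi.single_apply]

lemma coords_sum {ι' : Type*} (s : Finset ι') (c : ι' → ℝ) (A : ι' → Op n) :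
    σ.coords a x (∑ j ∈ s, c j • A j) = ∑ j ∈ s, c j • σ.coords a x (A j) := by
  ext i
  simp [coords_apply, gFS_sum_left, gFS_smul_left]

lemma coords_frame (hx : x ∈ σ.U a) (j : Fin r) : σ.coords a x (σ.frame a j x) = stdVec j := by
  ext i
  simp [coords_apply, σ.orthonormal a x hx, stdVec, eq_comm]

lemma inner_coords (hx : x ∈ σ.U a) (A : Op n) {B : Op n} (hB : B ∈ W x) :
    inner ℝ (σ.coords a x A) (σ.coords a x B) = gFS A B := by
  conv_rhs => rw [eq_sum_gFS_of_mem_span (σ.orthonormal a x hx) (A := B)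
    ((σ.span_eq a x hx).symm ▸ hB)]
  simp [PiLp.inner_apply, coords_apply, gFS_sum_right, gFS_smul_right]

lemma coords_eq_zero {A : Op n} (h : ∀ i, gFS A (σ.frame a i x) = 0) : σ.coords a x A = 0 := by
  ext i
  simp [coords_apply, h]

end Bundle

variable {f : M → CP n} {p q : ℕ} {ιM ιN : Type*}
  {SM SN : Type*} [NormedAddCommGroup SM] [InnerProductSpace ℂ SM]
  [NormedAddCommGroup SN] [InnerProductSpace ℂ SN]
  (σM : SpinStructure (k := k) (tangentM (k := k) f) (2 * p) ιM)
  (σN : SpinStructure (k := k) (normalM (k := k) f) (2 * q) ιN)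
  (cM : SpinorModule p SM) (cN : SpinorModule q SN) {a : ιM} {b : ιN} {x : M}

/-- The tensor product `A ⊗ B` of continuous endomorphisms, as a bilinear map. -/
def tensorEnd (SM SN : Type*) [NormedAddCommGroup SM] [InnerProductSpace ℂ SM]
    [NormedAddCommGroup SN] [InnerProductSpace ℂ SN] :
    (SM →L[ℂ] SM) →ₗ[ℂ] (SN →L[ℂ] SN) →ₗ[ℂ] Module.End ℂ (SM ⊗[ℂ] SN) :=
  (TensorProduct.mapBilinear (RingHom.id ℂ) SM SN SM SN).compl₁₂
    (ContinuousLinearMap.coeLM ℂ) (ContinuousLinearMap.coeLM ℂ)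

lemma tensorEnd_mul (A A' : SM →L[ℂ] SM) (B B' : SN →L[ℂ] SN) :
    tensorEnd SM SN A B * tensorEnd SM SN A' B' = tensorEnd SM SN (A * A') (B * B') :=
  (TensorProduct.map_mul A.toLinearMap A'.toLinearMap B.toLinearMap B'.toLinearMap).symm

lemma tensorEnd_one : tensorEnd SM SN 1 1 = 1 := TensorProduct.map_one

lemma cliff_eq (A : Op n) : cliff σM σN cM cN a b x A =
    tensorEnd SM SN (cM.cl (σM.coords a x A)) cN.volume +
      tensorEnd SM SN 1 (cN.cl (σN.coords b x A)) := rfl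

lemma cliff_sum {ι : Type*} (s : Finset ι) (c : ι → ℝ) (A : ι → Op n) :
    cliff σM σN cM cN a b x (∑ i ∈ s, c i • A i) =
      ∑ i ∈ s, (c i : ℂ) • cliff σM σN cM cN a b x (A i) := by
  have h1 : ∀ i, cM.cl (c i • σM.coords a x (A i)) = (c i : ℂ) • cM.cl (σM.coords a x (A i)) :=
    fun i => cM.cl_smul _ _
  have h2 : ∀ i, cN.cl (c i • σN.coords b x (A i)) = (c i : ℂ) • cN.cl (σN.coords b x (A i)) :=
    fun i => cN.cl_smul _ _
  simp only [cliff_eq, coords_sum, map_sum, h1, h2, smul_add, Finset.sum_add_distrib,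
    LinearMap.sum_apply, LinearMap.map_smul, LinearMap.smul_apply]

lemma cliff_tangent (hb : x ∈ σN.U b) (v : TangentSpace (𝓡 k) x) :
    cliff σM σN cM cN a b x (dF f x v) =
      tensorEnd SM SN (cM.cl (σM.coords a x (dF f x v))) cN.volume := by
  have h : σN.coords b x (dF f x v) = 0 := coords_eq_zero σN fun i => by
    rw [gFS_comm]; exact gFS_normal_tangent (frame_mem_normalM σN hb i) v
  rw [cliff_eq, h, map_zero, map_zero, add_zero]

lemma cliff_normal (ha : x ∈ σM.U a) {A : Op n} (hA : A ∈ normalM (k := k) f x) :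
    cliff σM σN cM cN a b x A = tensorEnd SM SN 1 (cN.cl (σN.coords b x A)) := by
  have h : σM.coords a x A = 0 := coords_eq_zero σM fun i =>
    hA.2 _ (σM.span_eq a x ha ▸ Submodule.subset_span ⟨i, rfl⟩)
  rw [cliff_eq, h, map_zero, map_zero, LinearMap.zero_apply, zero_add]

/-- Products of two tangent vectors act on the first factor only, as the volume element of the
normal bundle squares to `1`. -/
lemma cliff_tangent_mul (hb : x ∈ σN.U b) (v w : TangentSpace (𝓡 k) x) :
    cliff σM σN cM cN a b x (dF f x v) * cliff σM σN cM cN a b x (dF f x w) =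
      tensorEnd SM SN (cM.cl (σM.coords a x (dF f x v)) * cM.cl (σM.coords a x (dF f x w))) 1 := by
  rw [cliff_tangent σM σN cM cN hb, cliff_tangent σM σN cM cN hb, tensorEnd_mul,
    cN.volume_mul_self]

lemma cliff_normal_mul (ha : x ∈ σM.U a) {A B : Op n} (hA : A ∈ normalM (k := k) f x)
    (hB : B ∈ normalM (k := k) f x) :
    cliff σM σN cM cN a b x A * cliff σM σN cM cN a b x B =
      tensorEnd SM SN 1 (cN.cl (σN.coords b x A) * cN.cl (σN.coords b x B)) := by
  rw [cliff_normal σM σN cM cN ha hA, cliff_normal σM σN cM cN ha hB, tensorEnd_mul, one_mul]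

lemma kaehlerAction_tangent (hb : x ∈ σN.U b) {r : ℕ} (e : Fin r → TangentSpace (𝓡 k) x) :
    kaehlerAction (f x) (cliff σM σN cM cN a b x) (fun i => dF f x (e i)) =
      (1 / 2 : ℂ) • ∑ i, ∑ j, (gFS (cpxJ (f x) (dF f x (e i))) (dF f x (e j)) : ℂ) •
        tensorEnd SM SN (cM.cl (σM.coords a x (dF f x (e i))) *
          cM.cl (σM.coords a x (dF f x (e j)))) 1 := by
  simp only [kaehlerAction, cliff_tangent_mul σM σN cM cN hb]

lemma kaehlerAction_normal_frame (ha : x ∈ σM.U a) (hb : x ∈ σN.U b) :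
    kaehlerAction (f x) (cliff σM σN cM cN a b x) (fun i => σN.frame b i x) =
      (1 / 2 : ℂ) • tensorEnd SM SN 1 (∑ i, ∑ j,
        (gFS (cpxJ (f x) (σN.frame b i x)) (σN.frame b j x) : ℂ) •
          (cN.cl (stdVec i) * cN.cl (stdVec j))) := by
  have h : ∀ i j, cliff σM σN cM cN a b x (σN.frame b i x) *
      cliff σM σN cM cN a b x (σN.frame b j x) =
      tensorEnd SM SN 1 (cN.cl (stdVec i) * cN.cl (stdVec j)) := fun i j => by
    rw [cliff_normal_mul σM σN cM cN ha (frame_mem_normalM σN hb i)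
      (frame_mem_normalM σN hb j), coords_frame σN hb, coords_frame σN hb]
  simp only [kaehlerAction, h, map_sum, map_smul]

lemma kaehlerAction_mul (ha : x ∈ σM.U a) (hb : x ∈ σN.U b) {r : ℕ}
    (e : Fin r → TangentSpace (𝓡 k) x) :
    kaehlerAction (f x) (cliff σM σN cM cN a b x) (fun i => dF f x (e i)) *
      kaehlerAction (f x) (cliff σM σN cM cN a b x) (fun i => σN.frame b i x) =
      (1 / 4 : ℂ) • ∑ i, ∑ j, (gFS (cpxJ (f x) (dF f x (e i))) (dF f x (e j)) : ℂ) •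
        tensorEnd SM SN (cM.cl (σM.coords a x (dF f x (e i))) *
          cM.cl (σM.coords a x (dF f x (e j)))) (∑ i, ∑ j,
        (gFS (cpxJ (f x) (σN.frame b i x)) (σN.frame b j x) : ℂ) •
          (cN.cl (stdVec i) * cN.cl (stdVec j))) := by
  rw [kaehlerAction_tangent σM σN cM cN hb, kaehlerAction_normal_frame σM σN cM cN ha hb,
    smul_mul_assoc, mul_smul_comm, smul_smul, Finset.sum_mul]
  simp only [Finset.sum_mul, smul_mul_assoc, tensorEnd_mul, mul_one, one_mul]
  norm_num

variable [IsManifold (𝓡 k) ∞ M]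

/-- The curvature of `ΣN` in Clifford form: `¼ ∑_p (II(w, e_p) II(v, e_p) - II(v, e_p) II(w, e_p))`
minus `Ω(v, w)` times the Kähler form of the normal bundle. -/
lemma spinCurv_eq_clifford (hf : IsKaehlerImmersion (k := k) f) (hb : x ∈ σN.U b)
    {e : Fin k → TangentSpace (𝓡 k) x}
    (he : ∀ i j, gFS (dF f x (e i)) (dF f x (e j)) = if i = j then 1 else 0)
    (v w : TangentSpace (𝓡 k) x) :
    spinCurv σN cN b x v w = (1 / 4 : ℂ) • ∑ p,
        (cN.cl (σN.coords b x (II f x w (e p))) * cN.cl (σN.coords b x (II f x v (e p))) -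
          cN.cl (σN.coords b x (II f x v (e p))) * cN.cl (σN.coords b x (II f x w (e p)))) -
      ((gFS (cpxJ (f x) (dF f x v)) (dF f x w) : ℂ) / 2) • ∑ i, ∑ j,
        (gFS (cpxJ (f x) (σN.frame b i x)) (σN.frame b j x) : ℂ) •
          (cN.cl (stdVec i) * cN.cl (stdVec j)) := by
  have hII : ∀ v w : TangentSpace (𝓡 k) x, cN.cl (σN.coords b x (II f x v w)) =
      ∑ i, (gFS (II f x v w) (σN.frame b i x) : ℂ) • cN.cl (stdVec i) := by
    intro v w
    conv_lhs => rw [II_eq_sum σN hb v w, coords_sum]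
    simp only [map_sum, cN.cl_smul, coords_frame σN hb]
  have hprod : ∀ v w v' w' : TangentSpace (𝓡 k) x, cN.cl (σN.coords b x (II f x v w)) *
      cN.cl (σN.coords b x (II f x v' w')) = ∑ i, ∑ j,
        ((gFS (II f x v w) (σN.frame b i x) * gFS (II f x v' w') (σN.frame b j x) : ℝ) : ℂ) •
          (cN.cl (stdVec i) * cN.cl (stdVec j)) := by
    intro v w v' w'
    rw [hII, hII, Finset.sum_mul]
    refine Finset.sum_congr rfl fun i _ => ?_
    rw [Finset.mul_sum]
    refine Finset.sum_congr rfl fun j _ => ?_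
    rw [smul_mul_assoc, mul_smul_comm, smul_smul, Complex.ofReal_mul]
  rw [spinCurv_eq σN cN hb v w]
  have hcoef : ∀ i j, gFS (frameDeriv σN b x i w) (frameDeriv σN b x j v) -
        gFS (frameDeriv σN b x i v) (frameDeriv σN b x j w) +
        ∑ m, (gFS (frameDeriv σN b x i w) (σN.frame b m x) *
            gFS (frameDeriv σN b x m v) (σN.frame b j x) -
          gFS (frameDeriv σN b x i v) (σN.frame b m x) *
            gFS (frameDeriv σN b x m w) (σN.frame b j x)) =
      ∑ p, (gFS (II f x w (e p)) (σN.frame b i x) * gFS (II f x v (e p)) (σN.frame b j x) -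
        gFS (II f x v (e p)) (σN.frame b i x) * gFS (II f x w (e p)) (σN.frame b j x))
      - 2 * gFS (cpxJ (f x) (dF f x v)) (dF f x w) *
        gFS (cpxJ (f x) (σN.frame b i x)) (σN.frame b j x) := by
    intro i j
    rw [ricci_equation σN hf hb he v w i j]
    have h : ∀ m u, gFS (frameDeriv σN b x m u) (σN.frame b j x) =
        -gFS (frameDeriv σN b x j u) (σN.frame b m x) := fun m u => frameDeriv_skew σN hb u m j
    simp only [h, Finset.sum_sub_distrib, mul_neg, Finset.sum_neg_distrib]
    ring
  simp only [hcoef, cN.bivector_apply, hprod]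
  have e1 : ∑ p, (∑ i, ∑ j, ((gFS (II f x w (e p)) (σN.frame b i x) *
        gFS (II f x v (e p)) (σN.frame b j x) : ℝ) : ℂ) • (cN.cl (stdVec i) * cN.cl (stdVec j)) -
      ∑ i, ∑ j, ((gFS (II f x v (e p)) (σN.frame b i x) *
        gFS (II f x w (e p)) (σN.frame b j x) : ℝ) : ℂ) • (cN.cl (stdVec i) * cN.cl (stdVec j))) =
      ∑ i, ∑ j, ((∑ p, (gFS (II f x w (e p)) (σN.frame b i x) *
        gFS (II f x v (e p)) (σN.frame b j x) - gFS (II f x v (e p)) (σN.frame b i x) *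
        gFS (II f x w (e p)) (σN.frame b j x)) : ℝ) : ℂ) •
          (cN.cl (stdVec i) * cN.cl (stdVec j)) := by
    simp only [← Finset.sum_sub_distrib, ← sub_smul]
    rw [Finset.sum_comm]
    refine Finset.sum_congr rfl fun i _ => ?_
    rw [Finset.sum_comm]
    refine Finset.sum_congr rfl fun j _ => ?_
    rw [← Finset.sum_smul]
    push_cast
    rfl
  rw [e1, Finset.smul_sum, Finset.smul_sum, Finset.smul_sum, ← Finset.sum_sub_distrib]
  refine Finset.sum_congr rfl fun i _ => ?_
  rw [Finset.smul_sum, Finset.smul_sum, Finset.smul_sum, ← Finset.sum_sub_distrib]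
  refine Finset.sum_congr rfl fun j _ => ?_
  rw [smul_smul, smul_smul, smul_smul, ← sub_smul]
  congr 1
  push_cast
  ring

lemma mem_normalM_II (hb : x ∈ σN.U b) (v w : TangentSpace (𝓡 k) x) :
    II f x v w ∈ normalM (k := k) f x := by
  rw [II_eq_sum σN hb v w]
  exact Submodule.sum_mem _ fun m _ => Submodule.smul_mem _ _ (frame_mem_normalM σN hb m)

/-- The formula for the curvature endomorphism `R^E`, before pairing with a spinor. -/
lemma twistCurv_eq (hf : IsKaehlerImmersion (k := k) f) (ha : x ∈ σM.U a) (hb : x ∈ σN.U b)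
    {e : Fin k → TangentSpace (𝓡 k) x}
    (he : ∀ i j, gFS (dF f x (e i)) (dF f x (e j)) = if i = j then 1 else 0)
    {ν : Fin (2 * q) → Op n} (hν_mem : ∀ i, ν i ∈ normalM (k := k) f x)
    (hν : ∀ i j, gFS (ν i) (ν j) = if i = j then 1 else 0) :
    twistCurv σM σN cM cN a b x e =
      (-4 : ℂ) • (kaehlerAction (f x) (cliff σM σN cM cN a b x) (fun i => dF f x (e i)) *
        kaehlerAction (f x) (cliff σM σN cM cN a b x) ν)
      - ∑ i, ∑ j, ∑ p, cliff σM σN cM cN a b x (dF f x (e i)) *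
          cliff σM σN cM cN a b x (dF f x (e j)) * (cliff σM σN cM cN a b x (II f x (e i) (e p)) *
            cliff σM σN cM cN a b x (II f x (e j) (e p)))
      + (∑ i, ∑ p, (gFS (II f x (e i) (e p)) (II f x (e i) (e p)) : ℂ)) • 1 := by
  have hM : ∀ i j, cM.cl (σM.coords a x (dF f x (e i))) * cM.cl (σM.coords a x (dF f x (e j))) +
      cM.cl (σM.coords a x (dF f x (e j))) * cM.cl (σM.coords a x (dF f x (e i))) =
        (if i = j then -2 else 0 : ℂ) • 1 := by
    intro i j
    rw [cM.cl_anticomm, inner_coords σM ha (dF f x (e i)) (B := dF f x (e j)) ⟨e j, rfl⟩, he]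
    congr 1
    split_ifs <;> simp
  have hC : ∀ i p, cN.cl (σN.coords b x (II f x (e i) (e p))) *
      cN.cl (σN.coords b x (II f x (e i) (e p))) =
        -(gFS (II f x (e i) (e p)) (II f x (e i) (e p)) : ℂ) • 1 := by
    intro i p
    rw [cN.cl_mul_self, ← real_inner_self_eq_norm_sq, inner_coords σN hb _
      (mem_normalM_II σN hb _ _)]
    push_cast
    rfl
  have key := sum_curvature (tensorEnd SM SN) hM hC
    fun i j => spinCurv_eq_clifford σN cN hf hb he (e i) (e j)
  have hΩN := kaehlerAction_basis_change (f x) (cl := cliff σM σN cM cN a b x)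
    (fun c A => cliff_sum σM σN cM cN Finset.univ c A) hν
    (span_eq_of_gFS (σN.orthonormal b x hb) (σN.span_eq b x hb) hν hν_mem)
    (σN.orthonormal b x hb) (σN.span_eq b x hb)
  unfold twistCurv
  refine key.trans ?_
  rw [hΩN, tensorEnd_one]
  refine congrArg₂ (· + ·) (congrArg₂ (· - ·) ?_ ?_) rfl
  · rw [kaehlerAction_mul σM σN cM cN ha hb, smul_smul,
      show (-4 : ℂ) * (1 / 4) = -1 by norm_num, neg_one_smul]
  · refine Finset.sum_congr rfl fun i _ => Finset.sum_congr rfl fun j _ =>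
      Finset.sum_congr rfl fun p _ => ?_
    rw [cliff_tangent_mul σM σN cM cN hb, cliff_normal_mul σM σN cM cN ha
      (mem_normalM_II σN hb _ _) (mem_normalM_II σN hb _ _), tensorEnd_mul, mul_one, one_mul]

end Coords

section RePair

variable {S : Type*} [NormedAddCommGroup S] [InnerProductSpace ℂ S]

/-- `rePair` as an additive map of its first argument. -/
def rePairHom (φ : S) : S →+ ℝ where
  toFun ψ := rePair ψ φ
  map_zero' := by simp [rePair]
  map_add' ψ ψ' := by simp only [rePair, inner_add_left, Complex.add_re]

lemma rePair_smul (c : ℝ) (ψ φ : S) : rePair ((c : ℂ) • ψ) φ = c * rePair ψ φ := by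
  simp only [rePair, inner_smul_left, Complex.conj_ofReal, Complex.re_ofReal_mul]

lemma rePair_self {φ : S} (h : φ ≠ 0) : rePair φ φ = 1 := by
  have h' : ‖φ‖ ≠ 0 := norm_ne_zero_iff.2 h
  rw [rePair, inner_smul_right, inner_self_eq_norm_sq_to_K, Complex.re_ofReal_mul]
  norm_cast
  exact inv_mul_cancel₀ (pow_ne_zero 2 h')

end RePair

end KaehlerSpin

end

open KaehlerSpin
theorem proposition3p3 {n d : ℕ} {M : Type*} [TopologicalSpace M]
    [ChartedSpace (EuclideanSpace ℝ (Fin (2 * d))) M] [IsManifold (𝓡 (2 * d)) ∞ M]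
    (f : M → CP n) (hf : IsKaehlerImmersion (k := 2 * d) f)
    {ιM ιN : Type*}
    (σM : SpinStructure (k := 2 * d) (tangentM (k := 2 * d) f) (2 * d) ιM)
    (σN : SpinStructure (k := 2 * d) (normalM (k := 2 * d) f)
      (2 * (n - d)) ιN)
    {SM SN : Type*} [NormedAddCommGroup SM] [InnerProductSpace ℂ SM]
    [NormedAddCommGroup SN] [InnerProductSpace ℂ SN]
    (cM : SpinorModule d SM) (cN : SpinorModule (n - d) SN)
    (φ : SpinorField σM σN cM cN)
    (x : M) (a : ιM) (b : ιN) (ha : x ∈ σM.U a) (hb : x ∈ σN.U b) (hφ : φ.comp a b x ≠ 0)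
    (e : Fin (2 * d) → TangentSpace (𝓡 (2 * d)) x)
    (he : ∀ i j, gFS (dF f x (e i)) (dF f x (e j)) =
      if i = j then 1 else 0)
    (ν : Fin (2 * (n - d)) → Op n)
    (hν_mem : ∀ k, ν k ∈ normalM (k := 2 * d) f x)
    (hν : ∀ k l, gFS (ν k) (ν l) = if k = l then 1 else 0) :
    let cl : Op n → Module.End ℂ (TensorProduct ℂ SM SN) :=
      cliff σM σN cM cN a b x
    let Ω := kaehlerAction (f x) cl (fun i => dF f x (e i))
    let ΩN := kaehlerAction (f x) cl ν
    let ψ := φ.comp a b x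
    let II_x := II (k := 2 * d) f x
    rePair (twistCurv σM σN cM cN a b x e ψ) ψ =
      -4 * rePair (Ω (ΩN ψ)) ψ
      - ∑ i, ∑ j, ∑ p, rePair
          (cl (dF f x (e i)) (cl (dF f x (e j)) (cl (II_x (e i) (e p)) (cl (II_x (e j) (e p)) ψ)))) ψ
      + ∑ i, ∑ j, gFS (II_x (e i) (e j)) (II_x (e i) (e j)) := by
  intro cl Ω ΩN ψ II_x
  rw [twistCurv_eq σM σN cM cN hf ha hb he hν_mem hν]
  have hp : ∀ s, rePair s ψ = rePairHom ψ s := fun _ => rfl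
  have h4 : (-4 : ℂ) = ((-4 : ℝ) : ℂ) := by push_cast; rfl
  have h5 : (∑ i, ∑ p, (gFS (II f x (e i) (e p)) (II f x (e i) (e p)) : ℂ)) =
      ((∑ i, ∑ p, gFS (II f x (e i) (e p)) (II f x (e i) (e p)) : ℝ) : ℂ) := by push_cast; rfl
  rw [h4, h5]
  simp only [LinearMap.add_apply, LinearMap.sub_apply, LinearMap.smul_apply, LinearMap.sum_apply,
    Module.End.mul_apply, Module.End.one_apply]
  have hs : ∀ (c : ℝ) s, rePairHom ψ ((c : ℂ) • s) = c * rePairHom ψ s :=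
    fun c s => rePair_smul c s ψ
  have h1 : rePairHom ψ ψ = 1 := rePair_self hφ
  simp only [hp]
  rw [map_add, map_sub, hs, hs, h1, mul_one]
  simp only [map_sum]
  rfl
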